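/- **Least Alignment Lemma.** Fix integers $m, n_0 \ge 1$, a constant $d_{\max}$ and a function $f_{\max}:\mathbb R\to\mathbb R$. For a power $p>0$ and a block length $n$, consider a transmitter with $m$ antennas and two receivers $\mathrm{Rx}_1,\mathrm{Rx}_2$ with $n_0$ antennas each, with $$\vec y_j(t) = g_j(t)\,\vec x(t) + \vec z_j(t)\in\mathbb C^{n_0},\qquad j=1,2,\quad t=1,\dots,n,$$ where the noise $\vec z_j(t)\sim\mathcal{CN}(0,I_{n_0})$ is i.i.d. over $t$ and $j$, and the entries of the channel matrices $g_j(t)\in\mathbb C^{n_0\times m}$ are independent over antennas, time and receivers (for instance i.i.d.) and bounded by $d_{\max}$ in absolute value; each entry of each $g_2(t)$ has a density on $\mathbb C$ bounded by $f_{\max}(p)$. The laws of the entries may depend on $p$. An encoding strategy sends $\vec x(t)=f_t(W,U,(g_1(s))_{s\in K(t)})$, where $W$ is uniform on a finite nonempty message set, $U$ is private randomness, $W$, $U$, the channels and the noise are independent, the $f_t$ are measurable, and the sets $K(t)\subseteq\{1,\dots,n\}$ of times at which the channel of $\mathrm{Rx}_1$ is known to the transmitter are arbitrary ($K(t)=\{1,\dots,t-1\}$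 for delayed channel state information at the transmitter, CSIT); nothing about the realization of $g_2$ is available ($\mathrm{Rx}_2$ supplies no CSIT). The average power constraint $\frac1n\,\mathbb E\|\vec x^n\|^2\le p$ holds. Write $\mathcal G^n$ for all coefficients of both channels, and $h(\cdot\mid\mathcal G^n)$ for conditional differential entropy. 1. There is a function $\varepsilon(p)=o(\log p)$ as $p\to\infty$, depending only on $m,n_0,d_{\max}$ and the function $f_{\max}$, such that for every $p>0$, every $n$, all such channel laws and every such encoding strategy, $h(\vec y_1^n\mid\mathcal G^n)$ and $h(\vec y_2^n\mid\mathcal G^n)$ exist and are finite, and $$h(\vec y_1^n\mid\mathcal G^n)\le h(\vec y_2^n\mid\mathcal G^n)+n\,n_0\log f_{\max}(p)+n\,\varepsilon(p).$$ 2. If moreover $f_{\max}(p)=o(\log p)$, then there is a function $\varepsilon(p)=o(\log p)$ with the same dependence such that in the same generality both entropies exist and are finite, and $$h(\vec y_1^n\mid\mathcal G^n)\le h(\vec y_2^n\mid\mathcal G^n)+n\,\varepsilon(p).$$ -/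

import Mathlib

open MeasureTheory ProbabilityTheory Filter Asymptotics

namespace LeastAlignment

noncomputable section

/-! ### Conditional differential entropy -/

section Entropy

variable {Ω E Γ : Type*} [MeasurableSpace Ω] [MeasureSpace E] [MeasurableSpace Γ]

/-- The conditional density `f_{Y|G}(y | g)` of `Y` given `G`: the density of the joint law of
`(Y, G)` with respect to the product of the Lebesgue measure and the law of `G`. -/
def condDensity (P : Measure Ω) (Y : Ω → E) (G : Ω → Γ) : E × Γ → ENNReal :=
  (P.map fun ω => (Y ω, G ω)).rnDeriv ((volume : Measure E).prod (P.map G))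

/-- The conditional differential entropy `h(Y | G) = -E[log f_{Y|G}(Y | G)]` (in nats). -/
def condDiffEntropy (P : Measure Ω) (Y : Ω → E) (G : Ω → Γ) : ℝ :=
  -∫ ω, Real.log (condDensity P Y G (Y ω, G ω)).toReal ∂P

/-- `h(Y | G)` exists and is finite: `Y` has a conditional density given `G`, whose logarithm is
integrable. -/
structure HasCondDiffEntropy (P : Measure Ω) (Y : Ω → E) (G : Ω → Γ) : Prop where
  absolutelyContinuous :
    (P.map fun ω => (Y ω, G ω)) ≪ (volume : Measure E).prod (P.map G)
  integrable_log :
    Integrable (fun ω => Real.log (condDensity P Y G (Y ω, G ω)).toReal) P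

end Entropy

/-! ### The channel -/

/-- The coefficients of one receiver over a block: `g t j i` is the coefficient at time `t` from
transmit antenna `i` to receive antenna `j`. -/
abbrev ChannelBlock (n n₀ m : ℕ) : Type := Fin n → Fin n₀ → Fin m → ℂ

/-- A block of received signals (or of noise): `y t j` is the signal at time `t` on antenna `j`. -/
abbrev SignalBlock (n n₀ : ℕ) : Type := Fin n → Fin n₀ → ℂ

/-- The probability measure `ν` on `ℂ` has a density with respect to the Lebesgue measure on
`ℂ = ℝ²` which is bounded by `f`. -/
def HasDensityAtMost (ν : Measure ℂ) (f : ℝ) : Prop :=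
  ∃ φ : ℂ → ENNReal, Measurable φ ∧ (∀ c, φ c ≤ ENNReal.ofReal f) ∧ ν = volume.withDensity φ

/-- The laws of the channel coefficients of two receivers with `n₀` antennas each, over `n` time
slots. All coefficients are bounded in absolute value by `dmax`; those of the second receiver have
a density bounded by `f`. (In the i.i.d. case all these laws coincide.) -/
structure CoefLaws (n n₀ m : ℕ) (dmax f : ℝ) where
  law₁ : Fin n → Fin n₀ → Fin m → Measure ℂ
  law₂ : Fin n → Fin n₀ → Fin m → Measure ℂ
  isProb₁ : ∀ t j i, IsProbabilityMeasure (law₁ t j i)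
  isProb₂ : ∀ t j i, IsProbabilityMeasure (law₂ t j i)
  bounded₁ : ∀ t j i, ∀ᵐ c ∂(law₁ t j i), ‖c‖ ≤ dmax
  bounded₂ : ∀ t j i, ∀ᵐ c ∂(law₂ t j i), ‖c‖ ≤ dmax
  density₂ : ∀ t j i, HasDensityAtMost (law₂ t j i) f

/-- The law of a block of independent channel coefficients with given marginals. -/
def blockLaw {n n₀ m : ℕ} (law : Fin n → Fin n₀ → Fin m → Measure ℂ) :
    Measure (ChannelBlock n n₀ m) :=
  Measure.pi fun t => Measure.pi fun j => Measure.pi fun i => law t j i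

/-- The circularly symmetric complex Gaussian law `𝒞𝒩(0, 1)`: independent real and imaginary
parts, each of law `N(0, 1/2)`. -/
def complexGaussian : Measure ℂ :=
  ((gaussianReal 0 (1 / 2)).prod (gaussianReal 0 (1 / 2))).map fun q : ℝ × ℝ => ⟨q.1, q.2⟩

/-- The law of a block of additive noise: i.i.d. `𝒞𝒩(0, 1)` across time and antennas. -/
def noiseLaw (n n₀ : ℕ) : Measure (SignalBlock n n₀) :=
  Measure.pi fun _ => Measure.pi fun _ => complexGaussian

/-! ### Encoding strategies -/

/-- An encoding strategy of block length `n` for a message in `Fin M`. At time `t` the transmitter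
sends `enc t w u g₁`, where `w` is the message, `u : U` is private randomness, and `g₁` is the
channel to the first receiver, of which only the values at the times in `K t` may be used; the
channel to the second receiver is not available at all. Delayed knowledge of the first channel is
`K t = {s | s < t}`, instantaneous knowledge is `K t = {s | s ≤ t}`, none is `K t = ∅`; a
deterministic encoder is one that ignores `u`. -/
structure Code (n n₀ m M : ℕ) (U : Type*) [MeasurableSpace U] (K : Fin n → Set (Fin n)) where
  enc : Fin n → Fin M → U → ChannelBlock n n₀ m → Fin m → ℂ
  measurable_enc : ∀ t w,
    Measurable fun q : U × ChannelBlock n n₀ m => enc t w q.1 q.2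
  uses_only_csit : ∀ t w u g g', (∀ s ∈ K t, g s = g' s) → enc t w u g = enc t w u g'

/-- An outcome `(W, U, (G₁ⁿ, G₂ⁿ), (z₁ⁿ, z₂ⁿ))` of message, private randomness, channels and
noise. -/
abbrev Outcome (n n₀ m M : ℕ) (U : Type*) : Type _ :=
  Fin M × U × (ChannelBlock n n₀ m × ChannelBlock n n₀ m) × (SignalBlock n n₀ × SignalBlock n n₀)

/-- The law of the outcome: the message is uniform on `Fin M`, and message, private randomness
(of law `μU`), channel coefficients and noise are independent. -/
def outcomeLaw {n n₀ m : ℕ} {dmax f : ℝ} (laws : CoefLaws n n₀ m dmax f) (M : ℕ)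
    {U : Type*} [MeasurableSpace U] (μU : Measure U) : Measure (Outcome n n₀ m M U) :=
  (uniformOn (Set.univ : Set (Fin M))).prod
    (μU.prod (((blockLaw laws.law₁).prod (blockLaw laws.law₂)).prod
      ((noiseLaw n n₀).prod (noiseLaw n n₀))))

/-- All channel coefficients `𝒢ⁿ = (G₁ⁿ, G₂ⁿ)`. -/
def channels {n n₀ m M : ℕ} {U : Type*} (ω : Outcome n n₀ m M U) :
    ChannelBlock n n₀ m × ChannelBlock n n₀ m := ω.2.2.1

/-- The output `y(t) = g(t) x(t) + z(t)` of the Gaussian MIMO channel. -/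
def channelOutput {n n₀ m : ℕ} (g : ChannelBlock n n₀ m) (x : Fin n → Fin m → ℂ)
    (z : SignalBlock n n₀) : SignalBlock n n₀ :=
  fun t j => ∑ i, g t j i * x t i + z t j

namespace Code

variable {n n₀ m M : ℕ} {U : Type*} [MeasurableSpace U] {K : Fin n → Set (Fin n)}

/-- The transmitted block `xⁿ`. -/
def input (c : Code n n₀ m M U K) (ω : Outcome n n₀ m M U) : Fin n → Fin m → ℂ :=
  fun t => c.enc t ω.1 ω.2.1 ω.2.2.1.1

/-- The block `y₁ⁿ` received by the first receiver. -/
def output₁ (c : Code n n₀ m M U K) (ω : Outcome n n₀ m M U) : SignalBlock n n₀ :=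
  channelOutput ω.2.2.1.1 (c.input ω) ω.2.2.2.1

/-- The block `y₂ⁿ` received by the second receiver. -/
def output₂ (c : Code n n₀ m M U K) (ω : Outcome n n₀ m M U) : SignalBlock n n₀ :=
  channelOutput ω.2.2.1.2 (c.input ω) ω.2.2.2.2

/-- The average power constraint `(1/n) E‖xⁿ‖² ≤ p`. -/
def PowerConstraint (c : Code n n₀ m M U K) (P : Measure (Outcome n n₀ m M U)) (p : ℝ) : Prop :=
  ∫⁻ ω, ∑ t, ∑ i, ‖c.input ω t i‖ₑ ^ 2 ∂P ≤ n * ENNReal.ofReal p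

end Code

end

end LeastAlignment

/-! Both entropies are compared with one auxiliary function, by Gibbs' inequality (`log x ≤ x - 1`)
once at each receiver. Fix the first channel `g₁`. Two sources `a`, `a'` (message and private
randomness) then determine two inputs, whose difference `d` does not involve the second channel. On
one antenna of the second receiver the overlap of the two noisy receptions, averaged over channel
and noise, is at most `1/π`, and at most `f / |dᵢ|²` for every `i`, because a single coefficient
with density at most `f` already spreads `∑ cₖ dₖ` that much. The first receiver sees `|∑ gₖ dₖ| ≤ m
dmax maxᵢ |dᵢ|`, so the overlap is at most `f dmax² (1 + m²) / (1 + |∑ gₖ dₖ|²)`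
(`lintegral_doubleNoise_le_kernel`). On average, inputs align at the second receiver no more than at
the first.

Let `κ` be the conditional law of the noiseless signal `s₁` convolved with the product of the
kernels `1 / (1 + |u|²)` (`smoothedLaw`). Multiplying over times and antennas and averaging over
`a'`, the expected density of `y₂` given `a` and `g₁` is at most `C κ(s₁)`, where `C = (f dmax² (1 +
m²)) ^ (n n₀)`. Gibbs' inequality turns this into `-E log κ(s₁) ≤ h(y₂ | G) + log C`, and `log C`
contains the term `n n₀ log f`.

For the first receiver, `κ` is almost a density. The kernel varies slowly, so passing from `s₁` to
`y₁ = s₁ + z₁` costs a constant per antenna. The kernel fails to be integrable over `ℂ` only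
logarithmically; the factor `taper` repairs this and costs order `log log p`, since `y₁` has power
of order `p` for large `p`. Gibbs' inequality with this reference density bounds `h(y₁ | G)` by `-E
log κ(s₁)` plus these costs, and `entropy_le` adds the two bounds. -/

namespace LeastAlignment
noncomputable section

/-! ### Products of measures with densities -/

/-- Tonelli's theorem for a product of functions of one coordinate each. -/
theorem lintegral_pi_prod {n : ℕ} {E : Fin n → Type*} [∀ i, MeasurableSpace (E i)]
    (μ : ∀ i, Measure (E i)) [∀ i, SigmaFinite (μ i)] (f : ∀ i, E i → ENNReal)
    (hf : ∀ i, Measurable (f i)) :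
    ∫⁻ x, ∏ i, f i (x i) ∂(Measure.pi μ) = ∏ i, ∫⁻ x, f i x ∂(μ i) := by
  induction n with
  | zero => simp
  | succ n ih =>
    rw [← ((measurePreserving_piFinSuccAbove μ 0).symm).lintegral_comp_emb
      (MeasurableEquiv.measurableEmbedding _)]
    simp only [Fin.prod_univ_succ, Fin.zero_succAbove]
    rw [← ih (fun i => μ i.succ) (fun i => f i.succ) fun i => hf _]
    exact lintegral_prod_mul (μ := μ 0) (ν := Measure.pi fun i : Fin n => μ i.succ)
      (f := f 0) (g := fun x => ∏ i, f i.succ (x i)) (hf 0).aemeasurable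
      (Finset.measurable_fun_prod _ fun i _ =>
        (hf i.succ).comp (measurable_pi_apply i)).aemeasurable

theorem pi_withDensity {n : ℕ} {E : Fin n → Type*} [∀ i, MeasurableSpace (E i)]
    (μ : ∀ i, Measure (E i)) [∀ i, SigmaFinite (μ i)] (f : ∀ i, E i → ENNReal)
    (hf : ∀ i, Measurable (f i)) [∀ i, SigmaFinite ((μ i).withDensity (f i))] :
    (Measure.pi fun i => (μ i).withDensity (f i)) =
      (Measure.pi μ).withDensity fun x => ∏ i, f i (x i) := by
  refine Measure.pi_eq fun s hs => ?_
  rw [withDensity_apply _ (MeasurableSet.univ_pi hs), Measure.restrict_pi_pi,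
    lintegral_pi_prod _ _ hf]
  exact Finset.prod_congr rfl fun i _ => (withDensity_apply _ (hs i)).symm

/-! ### The Gaussian noise -/

/-- The density of the law `𝒞𝒩(0, 1)`. -/
def gaussDensity (z : ℂ) : ENNReal := ENNReal.ofReal (Real.pi⁻¹ * Real.exp (-‖z‖ ^ 2))

@[fun_prop]
theorem measurable_gaussDensity : Measurable gaussDensity := by
  unfold gaussDensity; fun_prop

theorem gaussDensity_pos (z : ℂ) : 0 < gaussDensity z := by
  unfold gaussDensity; rw [ENNReal.ofReal_pos]; positivity

theorem gaussDensity_le (z : ℂ) : gaussDensity z ≤ ENNReal.ofReal Real.pi⁻¹ := by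
  unfold gaussDensity
  refine ENNReal.ofReal_le_ofReal (mul_le_of_le_one_right (by positivity) ?_)
  exact Real.exp_le_one_iff.2 (by simp)

theorem gaussDensity_le_one (z : ℂ) : gaussDensity z ≤ 1 :=
  (gaussDensity_le z).trans <| ENNReal.ofReal_le_one.2 <|
    inv_le_one_of_one_le₀ (by linarith [Real.pi_gt_three])

instance : IsProbabilityMeasure complexGaussian :=
  Measure.isProbabilityMeasure_map (Complex.measurableEquivRealProd.symm.measurable.aemeasurable)

theorem complexGaussian_eq : complexGaussian = volume.withDensity gaussDensity := by
  have h0 : (1 / 2 : NNReal) ≠ 0 := by norm_num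
  have hm : Measurable (gaussianPDF 0 (1 / 2)) := measurable_gaussianPDF _ _
  have hp := Complex.volume_preserving_equiv_real_prod.symm
  unfold complexGaussian
  rw [gaussianReal_of_var_ne_zero _ h0, prod_withDensity hm hm]
  ext s hs
  have hf : Measurable fun q : ℝ × ℝ => (⟨q.1, q.2⟩ : ℂ) :=
    Complex.measurableEquivRealProd.symm.measurable
  rw [Measure.map_apply hf hs, withDensity_apply _ (hf hs), withDensity_apply _ hs,
    ← hp.setLIntegral_comp_preimage hs measurable_gaussDensity]
  refine lintegral_congr fun q => ?_
  simp only [gaussianPDF, gaussDensity, gaussianPDFReal,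
    Complex.measurableEquivRealProd_symm_apply]
  rw [← ENNReal.ofReal_mul (by positivity)]
  congr 1
  have h2 : (2 * Real.pi * ((1 / 2 : NNReal) : ℝ)) = Real.pi := by push_cast; ring
  have h3 : ‖(⟨q.1, q.2⟩ : ℂ)‖ ^ 2 = q.1 ^ 2 + q.2 ^ 2 := by
    rw [Complex.sq_norm, Complex.normSq_mk]; ring
  rw [h2, h3]
  have h4 : (√Real.pi)⁻¹ * (√Real.pi)⁻¹ = Real.pi⁻¹ := by
    rw [← mul_inv, Real.mul_self_sqrt Real.pi_pos.le]
  rw [mul_mul_mul_comm, h4, ← Real.exp_add]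
  congr 2
  push_cast; ring

theorem lintegral_gaussDensity : ∫⁻ z, gaussDensity z = 1 := by
  have h : complexGaussian Set.univ = 1 := measure_univ
  rwa [complexGaussian_eq, withDensity_apply _ MeasurableSet.univ, setLIntegral_univ] at h

theorem lintegral_sq_norm_complexGaussian :
    ∫⁻ z, ENNReal.ofReal (‖z‖ ^ 2) ∂complexGaussian = 1 := by
  have hsq : ∫⁻ x, ENNReal.ofReal (x ^ 2) ∂(gaussianReal 0 (1 / 2)) = ENNReal.ofReal (1 / 2) := by
    have hL : MemLp id 2 (gaussianReal 0 (1 / 2)) := memLp_id_gaussianReal 2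
    have hI : Integrable (fun x : ℝ => x ^ 2) (gaussianReal 0 (1 / 2)) := hL.integrable_sq
    rw [← ofReal_integral_eq_lintegral_ofReal hI
      (Eventually.of_forall fun x => sq_nonneg x)]
    congr 1
    have hv := variance_id_gaussianReal (μ := 0) (v := 1 / 2)
    rw [variance_eq_sub hL] at hv
    simpa using hv
  have hf : Measurable fun q : ℝ × ℝ => (⟨q.1, q.2⟩ : ℂ) :=
    Complex.measurableEquivRealProd.symm.measurable
  unfold complexGaussian
  rw [lintegral_map (by fun_prop) hf]
  have h3 : ∀ q : ℝ × ℝ, ENNReal.ofReal (‖(⟨q.1, q.2⟩ : ℂ)‖ ^ 2) =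
      ENNReal.ofReal (q.1 ^ 2) + ENNReal.ofReal (q.2 ^ 2) := fun q => by
    rw [← ENNReal.ofReal_add (by positivity) (by positivity), Complex.sq_norm, Complex.normSq_mk]
    congr 1; ring
  simp_rw [h3]
  rw [lintegral_add_left (by fun_prop), lintegral_prod _ (by fun_prop),
    lintegral_prod _ (by fun_prop)]
  simp only [lintegral_const, measure_univ, mul_one, hsq]
  rw [← ENNReal.ofReal_add (by norm_num) (by norm_num)]
  norm_num

instance (n n₀ : ℕ) : IsProbabilityMeasure (noiseLaw n n₀) := by
  unfold noiseLaw; infer_instance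

/-- The density of a block of noise. -/
def noiseDensity {n n₀ : ℕ} (z : SignalBlock n n₀) : ENNReal := ∏ t, ∏ j, gaussDensity (z t j)

@[fun_prop]
theorem measurable_noiseDensity {n n₀ : ℕ} : Measurable (noiseDensity (n := n) (n₀ := n₀)) := by
  unfold noiseDensity; fun_prop

theorem noiseLaw_eq (n n₀ : ℕ) : noiseLaw n n₀ = volume.withDensity noiseDensity := by
  have : SigmaFinite ((volume : Measure ℂ).withDensity gaussDensity) := by
    rw [← complexGaussian_eq]; infer_instance
  have h1 : (Measure.pi fun _ : Fin n₀ => complexGaussian) =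
      (volume : Measure (Fin n₀ → ℂ)).withDensity fun z => ∏ j, gaussDensity (z j) := by
    rw [complexGaussian_eq, volume_pi]
    exact pi_withDensity _ _ fun _ => measurable_gaussDensity
  have : SigmaFinite
      ((volume : Measure (Fin n₀ → ℂ)).withDensity fun z => ∏ j, gaussDensity (z j)) := by
    rw [← h1]; infer_instance
  unfold noiseLaw
  rw [h1, volume_pi]
  exact pi_withDensity _ _ fun _ => by fun_prop

theorem noiseDensity_pos {n n₀ : ℕ} (z : SignalBlock n n₀) : 0 < noiseDensity z :=
  CanonicallyOrderedAdd.prod_pos.2 fun _ _ => CanonicallyOrderedAdd.prod_pos.2 fun _ _ =>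
    gaussDensity_pos _

theorem noiseDensity_le_one {n n₀ : ℕ} (z : SignalBlock n n₀) : noiseDensity z ≤ 1 :=
  Finset.prod_le_one' fun _ _ => Finset.prod_le_one' fun _ _ => gaussDensity_le_one _

theorem lintegral_noiseDensity (n n₀ : ℕ) : ∫⁻ z : SignalBlock n n₀, noiseDensity z = 1 := by
  have h : noiseLaw n n₀ Set.univ = 1 := measure_univ
  rwa [noiseLaw_eq, withDensity_apply _ MeasurableSet.univ, setLIntegral_univ] at h

theorem neg_log_noiseDensity {n n₀ : ℕ} (z : SignalBlock n n₀) :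
    -Real.log (noiseDensity z).toReal = ∑ t, ∑ j, (Real.log Real.pi + ‖z t j‖ ^ 2) := by
  have h : ∀ w : ℂ, (gaussDensity w).toReal = Real.pi⁻¹ * Real.exp (-‖w‖ ^ 2) := fun w =>
    ENNReal.toReal_ofReal (by positivity)
  unfold noiseDensity
  simp_rw [ENNReal.toReal_prod, h]
  rw [Real.log_prod fun t _ => Finset.prod_ne_zero_iff.2 fun j _ => by positivity,
    ← Finset.sum_neg_distrib]
  refine Finset.sum_congr rfl fun t _ => ?_
  rw [Real.log_prod fun j _ => by positivity, ← Finset.sum_neg_distrib]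
  refine Finset.sum_congr rfl fun j _ => ?_
  rw [Real.log_mul (by positivity) (by positivity), Real.log_exp, Real.log_inv]
  ring

theorem lintegral_sum_sq_norm_noiseLaw (n n₀ : ℕ) :
    ∫⁻ z, ENNReal.ofReal (∑ t, ∑ j, ‖z t j‖ ^ 2) ∂(noiseLaw n n₀) = n * n₀ := by
  have h : ∀ z : SignalBlock n n₀, ENNReal.ofReal (∑ t, ∑ j, ‖z t j‖ ^ 2) =
      ∑ t, ∑ j, ENNReal.ofReal (‖z t j‖ ^ 2) := fun z => by
    rw [ENNReal.ofReal_sum_of_nonneg fun t _ => Finset.sum_nonneg fun j _ => by positivity]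
    exact Finset.sum_congr rfl fun t _ => ENNReal.ofReal_sum_of_nonneg fun j _ => by positivity
  simp_rw [h]
  rw [lintegral_finsetSum _ fun t _ => by fun_prop]
  have h2 : ∀ (t : Fin n) (j : Fin n₀),
      ∫⁻ z, ENNReal.ofReal (‖z t j‖ ^ 2) ∂(noiseLaw n n₀) = 1 := fun t j => by
    rw [← lintegral_sq_norm_complexGaussian]
    exact ((measurePreserving_eval (fun _ : Fin n₀ => complexGaussian) j).comp
      (measurePreserving_eval (fun _ : Fin n => Measure.pi fun _ : Fin n₀ => complexGaussian)
        t)).lintegral_comp (f := fun w => ENNReal.ofReal (‖w‖ ^ 2)) (by fun_prop)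
  have h3 : ∀ t : Fin n,
      ∫⁻ z, ∑ j, ENNReal.ofReal (‖z t j‖ ^ 2) ∂(noiseLaw n n₀) = n₀ := fun t => by
    rw [lintegral_finsetSum _ fun j _ => by fun_prop]
    simp only [h2, Finset.sum_const, Finset.card_univ, Fintype.card_fin, nsmul_eq_mul, mul_one]
  simp only [h3, Finset.sum_const, Finset.card_univ, Fintype.card_fin, nsmul_eq_mul]

/-! ### The alignment kernel and the taper -/

/-- The kernel `1 / (1 + |u|²)`, which is integrable on `ℂ` up to a logarithm. -/
def kernel (u : ℂ) : ENNReal := ENNReal.ofReal (1 + ‖u‖ ^ 2)⁻¹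

/-- The factor `(1 + log (1 + |y|²))⁻²`, which makes the kernel integrable. -/
def taper (y : ℂ) : ENNReal := ENNReal.ofReal ((1 + Real.log (1 + ‖y‖ ^ 2)) ^ 2)⁻¹

@[fun_prop]
theorem measurable_kernel : Measurable kernel := by unfold kernel; fun_prop

@[fun_prop]
theorem measurable_taper : Measurable taper := by unfold taper; fun_prop

theorem log_one_add_sq_nonneg (r : ℝ) : 0 ≤ Real.log (1 + r ^ 2) :=
  Real.log_nonneg (by nlinarith [sq_nonneg r])

theorem integrable_kernel_mul_taper :
    Integrable fun u : ℂ => (1 + ‖u‖ ^ 2)⁻¹ * ((1 + Real.log (1 + ‖u‖ ^ 2)) ^ 2)⁻¹ := by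
  rw [integrable_fun_norm_addHaar volume
    (f := fun r : ℝ => (1 + r ^ 2)⁻¹ * ((1 + Real.log (1 + r ^ 2)) ^ 2)⁻¹)]
  rw [Complex.finrank_real_complex]
  simp only [Nat.add_one_sub_one, pow_one, smul_eq_mul]
  -- In polar coordinates the integrand is `r / ((1 + r²) (1 + log (1 + r²))²)`, an exact derivative
  -- whose antiderivative tends to `0`. The exponent `2` of the logarithm is what makes it converge.
  refine integrableOn_Ioi_deriv_of_nonneg' (l := 0)
    (g := fun r => -(1 / 2) * (1 + Real.log (1 + r ^ 2))⁻¹) (fun r _ => ?_) (fun r hr => ?_) ?_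
  · have h0 := log_one_add_sq_nonneg r
    have h1 : (1 + r ^ 2) ≠ 0 := by positivity
    have h2 : (1 + Real.log (1 + r ^ 2)) ≠ 0 := by positivity
    have hd := (((((hasDerivAt_id r).pow 2).const_add 1).log h1).const_add 1).inv h2
      |>.const_mul (-(1 / 2))
    convert! hd using 1
    simp
    field_simp
  · have h0 := log_one_add_sq_nonneg r
    have hr' : 0 < r := hr
    positivity
  · have h1 : Tendsto (fun r : ℝ => 1 + r ^ 2) atTop atTop :=
      tendsto_atTop_add_const_left _ _ (tendsto_pow_atTop two_ne_zero)
    have h2 : Tendsto (fun r : ℝ => (1 + Real.log (1 + r ^ 2))⁻¹) atTop (nhds 0) :=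
      tendsto_inv_atTop_zero.comp
        (tendsto_atTop_add_const_left _ _ (Real.tendsto_log_atTop.comp h1))
    simpa only [mul_zero] using h2.const_mul (-(1 / 2))

/-- The integral of the tapered kernel over `ℂ`. -/
def taperedMass : ℝ := ∫ u : ℂ, (1 + ‖u‖ ^ 2)⁻¹ * ((1 + Real.log (1 + ‖u‖ ^ 2)) ^ 2)⁻¹

theorem lintegral_kernel_mul_taper :
    ∫⁻ u, kernel u * taper u = ENNReal.ofReal taperedMass := by
  rw [taperedMass, ofReal_integral_eq_lintegral_ofReal integrable_kernel_mul_taper]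
  · refine lintegral_congr fun u => ?_
    rw [kernel, taper, ENNReal.ofReal_mul (by positivity)]
  · exact Eventually.of_forall fun u => by
      simp only [Pi.zero_apply]; positivity

theorem kernel_le_kernel {u y : ℂ} (h : ‖y‖ ≤ ‖u‖) : kernel u ≤ kernel y := by
  unfold kernel; gcongr

theorem taper_le_taper {u y : ℂ} (h : ‖y‖ ≤ ‖u‖) : taper u ≤ taper y := by
  unfold taper
  have := log_one_add_sq_nonneg ‖y‖
  gcongr

/-- Both factors decrease with the norm, so the product only grows when both are evaluated at
whichever of `y` and `y - v` has the smaller norm. Adding the two cases and translating gives twice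
`taperedMass`, uniformly in `v`. -/
theorem lintegral_kernel_sub_mul_taper_le (v : ℂ) :
    ∫⁻ y, kernel (y - v) * taper y ≤ ENNReal.ofReal (2 * taperedMass) := by
  calc ∫⁻ y, kernel (y - v) * taper y
      ≤ ∫⁻ y, (kernel (y - v) * taper (y - v) + kernel y * taper y) := by
        refine lintegral_mono fun y => ?_
        rcases le_total ‖y‖ ‖y - v‖ with h | h
        · exact le_add_left (mul_le_mul_left (kernel_le_kernel h) _)
        · exact le_add_right (mul_le_mul_right (taper_le_taper h) _)
    _ = ENNReal.ofReal (2 * taperedMass) := by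
        rw [lintegral_add_left (by fun_prop),
          lintegral_sub_right_eq_self (fun y => kernel y * taper y) v, lintegral_kernel_mul_taper,
          two_mul, ENNReal.ofReal_add] <;>
        exact integral_nonneg fun u => by simp only [Pi.zero_apply]; positivity

theorem kernel_pos (u : ℂ) : 0 < kernel u := by
  unfold kernel; rw [ENNReal.ofReal_pos]; positivity

theorem taper_pos (u : ℂ) : 0 < taper u := by
  have := log_one_add_sq_nonneg ‖u‖
  unfold taper; rw [ENNReal.ofReal_pos]; positivity

theorem kernel_le_one (u : ℂ) : kernel u ≤ 1 :=
  ENNReal.ofReal_le_one.2 (inv_le_one_of_one_le₀ (by nlinarith [sq_nonneg ‖u‖]))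

theorem taperedMass_pos : 0 < taperedMass := by
  rw [← ENNReal.ofReal_pos, ← lintegral_kernel_mul_taper,
    lintegral_pos_iff_support (by fun_prop)]
  have : (Function.support fun u => kernel u * taper u) = Set.univ := by
    ext u; simp [(kernel_pos u).ne', (taper_pos u).ne']
  rw [this]; simp

/-- The kernel varies slowly. -/
theorem kernel_le_mul_kernel_add (u z : ℂ) :
    kernel u ≤ ENNReal.ofReal (2 * (1 + ‖z‖ ^ 2)) * kernel (u + z) := by
  unfold kernel
  rw [← ENNReal.ofReal_mul (by positivity)]
  refine ENNReal.ofReal_le_ofReal ?_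
  rw [← div_eq_mul_inv, le_div_iff₀ (by positivity), inv_mul_le_iff₀ (by positivity)]
  have h : ‖u + z‖ ≤ ‖u‖ + ‖z‖ := norm_add_le _ _
  have h' : ‖u + z‖ ^ 2 ≤ (‖u‖ + ‖z‖) ^ 2 := by gcongr
  nlinarith [sq_nonneg (‖u‖ - ‖z‖), sq_nonneg (‖u‖ * ‖z‖), sq_nonneg ‖u‖, sq_nonneg ‖z‖]

/-- Both logarithms are linearised by `log x ≤ x - 1`, at the scales `1 + p` and `1 + log (1 + p)`.
The resulting bound is affine in `‖y‖ ^ 2`, so a power of order `p` costs only order `log log p` in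
expectation. -/
theorem neg_log_taper_le {p : ℝ} (hp : 0 < p) (y : ℂ) :
    -Real.log (taper y).toReal ≤
      2 * Real.log (1 + Real.log (1 + p)) + 2 * ((1 + ‖y‖ ^ 2) / (1 + p)) := by
  have h0 := log_one_add_sq_nonneg ‖y‖
  have hT0 : 0 ≤ Real.log (1 + p) := Real.log_nonneg (by linarith)
  set L := 1 + Real.log (1 + ‖y‖ ^ 2)
  set T := 1 + Real.log (1 + p)
  have hL : 0 < L := by positivity
  have hT : 1 ≤ T := by simp [T, hT0]
  have h1 : Real.log (1 + ‖y‖ ^ 2) ≤ Real.log (1 + p) + (1 + ‖y‖ ^ 2) / (1 + p) - 1 := by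
    have := Real.log_le_sub_one_of_pos (x := (1 + ‖y‖ ^ 2) / (1 + p)) (by positivity)
    rw [Real.log_div (by positivity) (by positivity)] at this
    linarith
  have h2 : Real.log L ≤ Real.log T + (L / T - 1) := by
    have := Real.log_le_sub_one_of_pos (x := L / T) (by positivity)
    rw [Real.log_div (by positivity) (by positivity)] at this
    linarith
  have h3 : L / T - 1 ≤ (1 + ‖y‖ ^ 2) / (1 + p) := by
    rw [div_sub_one (by positivity), div_le_iff₀ (by positivity)]
    have : 0 ≤ (1 + ‖y‖ ^ 2) / (1 + p) := by positivity
    have hLT : L - T ≤ (1 + ‖y‖ ^ 2) / (1 + p) := by simp only [L, T]; linarith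
    nlinarith
  rw [taper, ENNReal.toReal_ofReal (by positivity), Real.log_inv, Real.log_pow]
  push_cast
  linarith


/-! ### Averaging over the second channel -/

/-- Multiplication by `d` scales area by `‖d‖ ^ 2`. Keeping this factor on the left avoids a
division and admits `d = 0`. -/
theorem lintegral_mul_add_le (d w : ℂ) {ψ : ℂ → ENNReal} (hψ : Measurable ψ) :
    ENNReal.ofReal (‖d‖ ^ 2) * ∫⁻ c, ψ (c * d + w) ≤ ∫⁻ c, ψ c := by
  rcases eq_or_ne d 0 with rfl | hd
  · simp
  have hdet : LinearMap.det (LinearMap.mul ℝ ℂ d) = ‖d‖ ^ 2 := by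
    rw [Complex.sq_norm, ← Algebra.norm_complex_apply]; rfl
  have hd2 : 0 < ‖d‖ ^ 2 := by positivity
  have hmap := Measure.map_linearMap_addHaar_eq_smul_addHaar (volume : Measure ℂ)
    (f := LinearMap.mul ℝ ℂ d) (by rw [hdet]; exact hd2.ne')
  rw [hdet, abs_of_pos (by positivity)] at hmap
  have h : ∫⁻ c, ψ (c * d + w) = ENNReal.ofReal (‖d‖ ^ 2)⁻¹ * ∫⁻ c, ψ c := by
    rw [← lintegral_add_right_eq_self ψ w, ← smul_eq_mul, ← lintegral_smul_measure, ← hmap,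
      lintegral_map (by fun_prop) (LinearMap.continuous_of_finiteDimensional _).measurable]
    exact lintegral_congr fun c => by rw [LinearMap.mul_apply', mul_comm]
  rw [h, ← mul_assoc, ← ENNReal.ofReal_mul hd2.le, mul_inv_cancel₀ hd2.ne']
  simp

theorem HasDensityAtMost.lintegral_le {ν : Measure ℂ} {f : ℝ} (h : HasDensityAtMost ν f)
    {ψ : ℂ → ENNReal} (hψ : Measurable ψ) :
    ∫⁻ c, ψ c ∂ν ≤ ENNReal.ofReal f * ∫⁻ c, ψ c := by
  obtain ⟨φ, hφ, hle, rfl⟩ := h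
  rw [lintegral_withDensity_eq_lintegral_mul _ hφ hψ, ← lintegral_const_mul _ hψ]
  exact lintegral_mono fun c => mul_le_mul_left (hle c) _

/-- A random linear combination spreads out at the rate of each of its coefficients. -/
theorem lintegral_sum_mul_le {m : ℕ} (ν : Fin m → Measure ℂ) [∀ i, IsProbabilityMeasure (ν i)]
    {f : ℝ} (d : Fin m → ℂ) (i : Fin m) (h : HasDensityAtMost (ν i) f)
    {ψ : ℂ → ENNReal} (hψ : Measurable ψ) :
    ENNReal.ofReal (‖d i‖ ^ 2) * ∫⁻ g, ψ (∑ k, g k * d k) ∂(Measure.pi ν) ≤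
      ENNReal.ofReal f * ∫⁻ c, ψ c := by
  obtain ⟨m, rfl⟩ : ∃ m', m = m' + 1 := ⟨m - 1, by have := i.pos; omega⟩
  rw [← ((measurePreserving_piFinSuccAbove ν i).symm).lintegral_comp_emb
      (MeasurableEquiv.measurableEmbedding _)]
  have hsum : ∀ q : ℂ × (Fin m → ℂ),
      ∑ k, (MeasurableEquiv.piFinSuccAbove (fun _ => ℂ) i).symm q k * d k =
        q.1 * d i + ∑ k, q.2 k * d (i.succAbove k) := fun q => by
    rw [Fin.sum_univ_succAbove _ i]
    simp [MeasurableEquiv.piFinSuccAbove_symm_apply, Fin.insertNthEquiv]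
  simp only [hsum]
  -- The other coefficients are frozen and act as a translation; only the `i`-th one is averaged
  -- with its density bound.
  rw [lintegral_prod_symm' _ (by fun_prop), ← lintegral_const_mul' _ _ ENNReal.ofReal_ne_top]
  calc _ ≤ ∫⁻ _, ENNReal.ofReal f * (∫⁻ c, ψ c)
        ∂(Measure.pi fun k => ν (i.succAbove k)) := by
        refine lintegral_mono fun y => ?_
        calc _ ≤ ENNReal.ofReal (‖d i‖ ^ 2) * (ENNReal.ofReal f *
                ∫⁻ c, ψ (c * d i + ∑ k, y k * d (i.succAbove k))) :=
              mul_le_mul_right (h.lintegral_le (by fun_prop)) _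
          _ ≤ _ := by
              rw [mul_left_comm]
              exact mul_le_mul_right (lintegral_mul_add_le _ _ hψ) _
    _ = _ := by simp

/-- The density of the sum of two independent noise variables. -/
def doubleNoise (w : ℂ) : ENNReal := ∫⁻ z, gaussDensity (z + w) ∂complexGaussian

@[fun_prop]
theorem measurable_doubleNoise : Measurable doubleNoise := by
  unfold doubleNoise
  exact Measurable.lintegral_prod_right' (f := fun q : ℂ × ℂ => gaussDensity (q.2 + q.1))
    (by fun_prop)

theorem doubleNoise_le (w : ℂ) : doubleNoise w ≤ ENNReal.ofReal Real.pi⁻¹ :=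
  (lintegral_mono fun z => gaussDensity_le (z + w)).trans (by simp)

theorem lintegral_doubleNoise : ∫⁻ w, doubleNoise w = 1 := by
  unfold doubleNoise
  rw [lintegral_lintegral_swap (by fun_prop)]
  simp [lintegral_add_left_eq_self gaussDensity, lintegral_gaussDensity]

/-- The expected overlap of two noisy receptions at difference `d` of the inputs, on one antenna
of the second receiver, in terms of a linear combination seen by the first receiver. -/
theorem lintegral_doubleNoise_le_kernel {m : ℕ} (hm : 1 ≤ m) (ν : Fin m → Measure ℂ)
    [∀ i, IsProbabilityMeasure (ν i)] {f dmax : ℝ} (hν : ∀ i, HasDensityAtMost (ν i) f)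
    (hf : Real.pi⁻¹ ≤ f * dmax ^ 2) (d g : Fin m → ℂ) (hg : ∀ i, ‖g i‖ ≤ dmax) :
    ∫⁻ c, doubleNoise (∑ k, c k * d k) ∂(Measure.pi ν) ≤
      ENNReal.ofReal (f * dmax ^ 2 * (1 + m ^ 2)) * kernel (∑ k, g k * d k) := by
  have : Nonempty (Fin m) := ⟨⟨0, hm⟩⟩
  -- The largest `‖d i‖` spreads the second receiver's combination most and also controls the first
  -- receiver's combination `u`.
  obtain ⟨i, -, hi⟩ := Finset.exists_max_image Finset.univ (fun k => ‖d k‖) Finset.univ_nonempty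
  have hd0 : 0 ≤ dmax := (norm_nonneg _).trans (hg i)
  have hfd : 0 < f * dmax ^ 2 := (by positivity : 0 < Real.pi⁻¹).trans_le hf
  have hf0 : 0 < f := pos_of_mul_pos_left hfd (by positivity)
  set X := ∫⁻ c, doubleNoise (∑ k, c k * d k) ∂(Measure.pi ν) with hX
  set u := ∑ k, g k * d k with hu
  have hule : ‖u‖ ≤ m * dmax * ‖d i‖ := by
    calc ‖u‖ ≤ ∑ k : Fin m, ‖g k * d k‖ := norm_sum_le _ _
      _ ≤ ∑ k : Fin m, dmax * ‖d i‖ := Finset.sum_le_sum fun k _ => by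
          rw [norm_mul]
          exact mul_le_mul (hg k) (hi k (Finset.mem_univ k)) (norm_nonneg _) hd0
      _ = _ := by simp; ring
  -- `hX1` is the bound for small `d`, `hX2` the one for large `d`. In `x * (1 + ‖u‖ ^ 2)` the first
  -- serves the summand `1`, by `hf`, and the second the summand `‖u‖ ^ 2`.
  have hX1 : X ≤ ENNReal.ofReal Real.pi⁻¹ :=
    (lintegral_mono fun c => doubleNoise_le _).trans (by simp)
  have hX2 : ENNReal.ofReal (‖d i‖ ^ 2) * X ≤ ENNReal.ofReal f := by
    have := lintegral_sum_mul_le ν d i (hν i) measurable_doubleNoise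
    rwa [lintegral_doubleNoise, mul_one] at this
  have hXtop : X ≠ ⊤ := (hX1.trans_lt ENNReal.ofReal_lt_top).ne
  lift X to NNReal using hXtop with x
  have h1 : (x : ℝ) ≤ Real.pi⁻¹ := by
    rw [← ENNReal.ofReal_coe_nnreal] at hX1
    exact (ENNReal.ofReal_le_ofReal_iff (by positivity)).1 hX1
  have h2 : ‖d i‖ ^ 2 * x ≤ f := by
    rw [← ENNReal.ofReal_coe_nnreal, ← ENNReal.ofReal_mul (by positivity)] at hX2
    exact (ENNReal.ofReal_le_ofReal_iff hf0.le).1 hX2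
  rw [kernel, ← ENNReal.ofReal_mul (by positivity), ← ENNReal.ofReal_coe_nnreal]
  refine ENNReal.ofReal_le_ofReal ?_
  rw [← div_eq_mul_inv, le_div_iff₀ (by positivity)]
  have hu2 : ‖u‖ ^ 2 ≤ (m * dmax) ^ 2 * ‖d i‖ ^ 2 := by
    rw [← mul_pow]; gcongr
  calc (x : ℝ) * (1 + ‖u‖ ^ 2) ≤ x * (1 + (m * dmax) ^ 2 * ‖d i‖ ^ 2) := by gcongr
    _ = x + (m * dmax) ^ 2 * (‖d i‖ ^ 2 * x) := by ring
    _ ≤ f * dmax ^ 2 + (m * dmax) ^ 2 * f := by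
        gcongr; exact h1.trans hf
    _ = _ := by ring

/-- A probability measure on a disc of radius `dmax` has density at least `1 / (π dmax²)`. -/
theorem HasDensityAtMost.inv_pi_le {ν : Measure ℂ} [IsProbabilityMeasure ν] {f dmax : ℝ}
    (h : HasDensityAtMost ν f) (hb : ∀ᵐ c ∂ν, ‖c‖ ≤ dmax) : Real.pi⁻¹ ≤ f * dmax ^ 2 := by
  obtain ⟨c, hc⟩ := hb.exists
  have hd0 : 0 ≤ dmax := (norm_nonneg c).trans hc
  have h1 : ν (Metric.closedBall 0 dmax) = 1 :=
    (prob_compl_eq_zero_iff Metric.isClosed_closedBall.measurableSet).1 <| by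
      rw [ae_iff] at hb
      simpa [Set.compl_def] using hb
  have h2 := h.lintegral_le
    (ψ := (Metric.closedBall (0 : ℂ) dmax).indicator 1)
    (measurable_one.indicator Metric.isClosed_closedBall.measurableSet)
  rw [lintegral_indicator_one Metric.isClosed_closedBall.measurableSet,
    lintegral_indicator_one Metric.isClosed_closedBall.measurableSet, h1,
    Complex.volume_closedBall, ← ENNReal.ofReal_pow hd0, ← ENNReal.ofReal_coe_nnreal, NNReal.coe_real_pi,
    ← ENNReal.ofReal_mul (by positivity), ← ENNReal.ofReal_mul' (by positivity),
    ENNReal.one_le_ofReal] at h2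
  rw [inv_le_iff_one_le_mul₀ Real.pi_pos]
  linarith

theorem isProbabilityMeasure_blockLaw {n n₀ m : ℕ} {law : Fin n → Fin n₀ → Fin m → Measure ℂ}
    (h : ∀ t j i, IsProbabilityMeasure (law t j i)) : IsProbabilityMeasure (blockLaw law) := by
  unfold blockLaw; infer_instance

theorem ae_blockLaw {n n₀ m : ℕ} {law : Fin n → Fin n₀ → Fin m → Measure ℂ}
    (h : ∀ t j i, IsProbabilityMeasure (law t j i)) {S : ℂ → Prop}
    (hS : ∀ t j i, ∀ᵐ c ∂(law t j i), S c) :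
    ∀ᵐ g ∂(blockLaw law), ∀ t j i, S (g t j i) := by
  simp only [ae_all_iff]
  intro t j i
  exact (((measurePreserving_eval (law t j) i).comp
    (measurePreserving_eval (fun j => Measure.pi (law t j)) j)).comp
      (measurePreserving_eval (fun t => Measure.pi fun j => Measure.pi (law t j))
        t)).quasiMeasurePreserving.ae (hS t j i)

/-- The noiseless reception of the input block `x` through the channel `g`. -/
def received {n n₀ m : ℕ} (g : ChannelBlock n n₀ m) (x : Fin n → Fin m → ℂ) : SignalBlock n n₀ :=
  fun t j => ∑ i, g t j i * x t i

/-- For a fixed input difference `d` the coefficients and the noise are independent over times and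
antennas, so the overlap of the blocks factors into the scalar overlaps. -/
theorem lintegral_noiseDensity_le_kernel {n n₀ m : ℕ} (hm : 1 ≤ m)
    {law : Fin n → Fin n₀ → Fin m → Measure ℂ} (hp : ∀ t j i, IsProbabilityMeasure (law t j i))
    {f dmax : ℝ} (hν : ∀ t j i, HasDensityAtMost (law t j i) f)
    (hb : ∀ t j i, ∀ᵐ c ∂(law t j i), ‖c‖ ≤ dmax)
    (d : Fin n → Fin m → ℂ) (g : ChannelBlock n n₀ m) (hg : ∀ t j i, ‖g t j i‖ ≤ dmax) :
    ∫⁻ g₂, ∫⁻ z, noiseDensity (z + received g₂ d) ∂(noiseLaw n n₀) ∂(blockLaw law) ≤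
      ENNReal.ofReal (f * dmax ^ 2 * (1 + m ^ 2)) ^ (n * n₀) *
        ∏ t, ∏ j, kernel (received g d t j) := by
  have h1 : ∀ g₂ : ChannelBlock n n₀ m,
      ∫⁻ z, noiseDensity (z + received g₂ d) ∂(noiseLaw n n₀) =
        ∏ t, ∏ j, doubleNoise (∑ k, g₂ t j k * d t k) := fun g₂ => by
    refine (lintegral_pi_prod (fun _ : Fin n => Measure.pi fun _ : Fin n₀ => complexGaussian)
      (fun t z => ∏ j, gaussDensity (z j + ∑ k, g₂ t j k * d t k)) fun t => by fun_prop).trans ?_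
    refine Finset.prod_congr rfl fun t _ => ?_
    exact lintegral_pi_prod (fun _ : Fin n₀ => complexGaussian)
      (fun j z => gaussDensity (z + ∑ k, g₂ t j k * d t k)) fun j => by fun_prop
  simp only [h1]
  unfold blockLaw
  rw [lintegral_pi_prod (fun t => Measure.pi fun j => Measure.pi fun i => law t j i)
      (fun t c => ∏ j, doubleNoise (∑ k, c j k * d t k)) fun t => by fun_prop]
  calc _ ≤ ∏ t : Fin n, ∏ j : Fin n₀,
        (ENNReal.ofReal (f * dmax ^ 2 * (1 + m ^ 2)) * kernel (received g d t j)) := by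
        refine Finset.prod_le_prod' fun t _ => ?_
        rw [lintegral_pi_prod (fun j => Measure.pi fun i => law t j i)
          (fun j c => doubleNoise (∑ k, c k * d t k)) fun j => by fun_prop]
        refine Finset.prod_le_prod' fun j _ => ?_
        exact lintegral_doubleNoise_le_kernel hm _ (hν t j)
          ((hν t j ⟨0, hm⟩).inv_pi_le (hb t j ⟨0, hm⟩)) _ _ (hg t j)
    _ = _ := by
        simp only [Finset.prod_mul_distrib, Finset.prod_const, Finset.card_univ,
          Fintype.card_fin, ← pow_mul]
        rw [mul_comm n₀ n]


/-! ### Entropy of a pair with an explicit conditional density -/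

section ExplicitDensity

variable {Ω E Γ : Type*} [MeasurableSpace Ω] [MeasureSpace E] [SigmaFinite (volume : Measure E)]
  [MeasurableSpace Γ] {P : Measure Ω} {γ : Measure Γ} [SigmaFinite γ]
  {Y : Ω → E} {G : Ω → Γ} {ρ : E × Γ → ENNReal}

/-- The Radon–Nikodym derivative is unique almost everywhere for the reference measure, hence also
for the joint law, which is absolutely continuous. -/
theorem condDensity_ae_eq (hY : Measurable Y) (hG : Measurable G) (hρ : Measurable ρ)
    (hγ : P.map G = γ)
    (hmap : (P.map fun ω => (Y ω, G ω)) = ((volume : Measure E).prod γ).withDensity ρ) :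
    ∀ᵐ ω ∂P, condDensity P Y G (Y ω, G ω) = ρ (Y ω, G ω) := by
  have h : condDensity P Y G =ᵐ[(volume : Measure E).prod γ] ρ := by
    unfold condDensity
    rw [hmap, hγ]
    exact Measure.rnDeriv_withDensity _ hρ
  have h' : ∀ᵐ q ∂(P.map fun ω => (Y ω, G ω)), condDensity P Y G q = ρ q := by
    rw [hmap]
    exact (withDensity_absolutelyContinuous _ _).ae_le h
  exact ae_of_ae_map (hY.prodMk hG).aemeasurable h'

theorem condDiffEntropy_eq (hY : Measurable Y) (hG : Measurable G) (hρ : Measurable ρ)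
    (hγ : P.map G = γ)
    (hmap : (P.map fun ω => (Y ω, G ω)) = ((volume : Measure E).prod γ).withDensity ρ) :
    condDiffEntropy P Y G = -∫ ω, Real.log (ρ (Y ω, G ω)).toReal ∂P := by
  unfold condDiffEntropy
  congr 1
  refine integral_congr_ae ?_
  filter_upwards [condDensity_ae_eq hY hG hρ hγ hmap] with ω hω
  rw [hω]

/-- The likelihood ratio of a conditional subdensity has expectation at most one. -/
theorem lintegral_div_density_le_one [IsProbabilityMeasure γ]
    (hY : Measurable Y) (hG : Measurable G) (hρ : Measurable ρ)
    (hmap : (P.map fun ω => (Y ω, G ω)) = ((volume : Measure E).prod γ).withDensity ρ)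
    {r : E × Γ → ENNReal} (hr : Measurable r) (hr1 : ∀ g, ∫⁻ y, r (y, g) ≤ 1) :
    ∫⁻ ω, r (Y ω, G ω) / ρ (Y ω, G ω) ∂P ≤ 1 := by
  rw [← lintegral_map (f := fun q => r q / ρ q) (by fun_prop) (hY.prodMk hG), hmap,
    lintegral_withDensity_eq_lintegral_mul _ hρ (by fun_prop)]
  calc _ ≤ ∫⁻ q, r q ∂((volume : Measure E).prod γ) :=
        lintegral_mono fun q => ENNReal.mul_div_le
    _ = ∫⁻ g, (∫⁻ y, r (y, g)) ∂γ := lintegral_prod_symm _ hr.aemeasurable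
    _ ≤ ∫⁻ _, 1 ∂γ := lintegral_mono hr1
    _ = 1 := by simp

/-- **Gibbs' inequality**, in its pointwise form. -/
theorem neg_log_toReal_le {a b : ENNReal} (ha : 0 < a) (ha' : a ≠ ⊤) (hb : 0 < b) (hb' : b ≠ ⊤) :
    -Real.log a.toReal ≤ -Real.log b.toReal + ((b / a).toReal - 1) := by
  have ha0 : 0 < a.toReal := ENNReal.toReal_pos ha.ne' ha'
  have hb0 : 0 < b.toReal := ENNReal.toReal_pos hb.ne' hb'
  have := Real.log_le_sub_one_of_pos (x := b.toReal / a.toReal) (by positivity)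
  rw [Real.log_div hb0.ne' ha0.ne'] at this
  rw [ENNReal.toReal_div]
  linarith

/-- Since `ρ ≤ 1`, only `-log ρ` needs an upper bound. Gibbs' inequality against the fixed
subdensity `φ` gives one: `-log φ` plus a likelihood ratio of expectation at most one. -/
theorem integrable_log_density [IsProbabilityMeasure γ]
    (hY : Measurable Y) (hG : Measurable G) (hρ : Measurable ρ)
    (hmap : (P.map fun ω => (Y ω, G ω)) = ((volume : Measure E).prod γ).withDensity ρ)
    (hρ0 : ∀ q, 0 < ρ q) (hρ1 : ∀ q, ρ q ≤ 1)
    {φ : E → ENNReal} (hφ : Measurable φ) (hφ0 : ∀ y, 0 < φ y) (hφ' : ∀ y, φ y ≠ ⊤)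
    (hφ1 : ∫⁻ y, φ y ≤ 1) (hint : Integrable (fun ω => Real.log (φ (Y ω)).toReal) P) :
    Integrable (fun ω => Real.log (ρ (Y ω, G ω)).toReal) P := by
  have hle : ∫⁻ ω, φ (Y ω) / ρ (Y ω, G ω) ∂P ≤ 1 :=
    lintegral_div_density_le_one hY hG hρ hmap (r := fun q => φ q.1) (by fun_prop)
      fun _ => hφ1
  have hI : Integrable (fun ω => (φ (Y ω) / ρ (Y ω, G ω)).toReal) P :=
    integrable_toReal_of_lintegral_ne_top
      ((hφ.comp hY).div (hρ.comp (hY.prodMk hG))).aemeasurable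
      (hle.trans_lt ENNReal.one_lt_top).ne
  refine Integrable.mono' ((hint.neg).add hI)
    ((hρ.comp (hY.prodMk hG)).ennreal_toReal.log).aestronglyMeasurable
    (Eventually.of_forall fun ω => ?_)
  have hρt : ρ (Y ω, G ω) ≠ ⊤ := ((hρ1 _).trans_lt ENNReal.one_lt_top).ne
  have h1 : Real.log (ρ (Y ω, G ω)).toReal ≤ 0 := by
    refine Real.log_nonpos ENNReal.toReal_nonneg ?_
    simpa using ENNReal.toReal_mono ENNReal.one_ne_top (hρ1 (Y ω, G ω))
  have h2 := neg_log_toReal_le (hρ0 (Y ω, G ω)) hρt (hφ0 (Y ω)) (hφ' (Y ω))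
  rw [Real.norm_of_nonpos h1]
  simp only [Pi.add_apply, Pi.neg_apply]
  linarith

end ExplicitDensity

/-! ### Signals in Gaussian noise -/

section Mixture

variable {n n₀ : ℕ} {Ω A Γ : Type*} [MeasurableSpace Ω] [MeasurableSpace A] [MeasurableSpace Γ]
  {P : Measure Ω} {α : Measure A} [IsProbabilityMeasure α]
  {γ : Measure Γ} [IsProbabilityMeasure γ]

/-- The conditional density, given `g`, of the noisy signal `s (a, g) + z`, where `a` has law
`α`. -/
def mixtureDensity (α : Measure A) (s : A × Γ → SignalBlock n n₀)
    (q : SignalBlock n n₀ × Γ) : ENNReal :=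
  ∫⁻ a, noiseDensity (q.1 - s (a, q.2)) ∂α

theorem measurable_mixtureDensity {s : A × Γ → SignalBlock n n₀} (hs : Measurable s) :
    Measurable (mixtureDensity α s) := by
  unfold mixtureDensity
  exact Measurable.lintegral_prod_right'
    (f := fun q : (SignalBlock n n₀ × Γ) × A => noiseDensity (q.1.1 - s (q.2, q.1.2)))
    (by fun_prop)

theorem lintegral_pos_of_forall {f : A → ENNReal} (hf : Measurable f) (h0 : ∀ a, 0 < f a) :
    0 < ∫⁻ a, f a ∂α := by
  rw [lintegral_pos_iff_support hf]
  have : Function.support f = Set.univ := by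
    ext a; simp [(h0 a).ne']
  simp [this]

theorem mixtureDensity_pos {s : A × Γ → SignalBlock n n₀} (hs : Measurable s)
    (q : SignalBlock n n₀ × Γ) : 0 < mixtureDensity α s q :=
  lintegral_pos_of_forall (by fun_prop) fun _ => noiseDensity_pos _

theorem mixtureDensity_le_one {Γ : Type*} (s : A × Γ → SignalBlock n n₀) (q : SignalBlock n n₀ × Γ) :
    mixtureDensity α s q ≤ 1 :=
  (lintegral_mono fun _ => noiseDensity_le_one _).trans (by simp)

theorem map_signal_add_noise {a : Ω → A} {G : Ω → Γ} {z : Ω → SignalBlock n n₀}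
    (h : MeasurePreserving (fun ω => (a ω, G ω, z ω)) P (α.prod (γ.prod (noiseLaw n n₀))))
    {s : A × Γ → SignalBlock n n₀} (hs : Measurable s) :
    (P.map fun ω => (s (a ω, G ω) + z ω, G ω)) =
      ((volume : Measure (SignalBlock n n₀)).prod γ).withDensity (mixtureDensity α s) := by
  have hm := measurable_mixtureDensity (α := α) hs
  refine Measure.ext_of_lintegral _ fun F hF => ?_
  have hcomp : (fun ω => (s (a ω, G ω) + z ω, G ω)) =
      (fun q : A × Γ × SignalBlock n n₀ => (s (q.1, q.2.1) + q.2.2, q.2.1)) ∘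
        fun ω => (a ω, G ω, z ω) := rfl
  rw [hcomp, ← Measure.map_map (by fun_prop) h.measurable, h.map_eq,
    lintegral_map hF (by fun_prop), lintegral_prod _ (by fun_prop),
    lintegral_withDensity_eq_lintegral_mul _ hm hF,
    lintegral_prod_symm _ (hm.mul hF).aemeasurable]
  have h1 : ∀ b : A, ∫⁻ q : Γ × SignalBlock n n₀, F (s (b, q.1) + q.2, q.1)
        ∂(γ.prod (noiseLaw n n₀)) =
      ∫⁻ g, (∫⁻ y, noiseDensity (y - s (b, g)) * F (y, g)) ∂γ := fun b => by
    rw [lintegral_prod _ (by fun_prop)]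
    refine lintegral_congr fun g => ?_
    rw [noiseLaw_eq, lintegral_withDensity_eq_lintegral_mul _ (by fun_prop) (by fun_prop),
      -- For fixed source and channel, translation by the signal turns the noise density into the
      -- density of the output.
      ← lintegral_add_right_eq_self (fun y => noiseDensity (y - s (b, g)) * F (y, g)) (s (b, g))]
    refine lintegral_congr fun y => ?_
    simp only [Pi.mul_apply, add_comm y, add_sub_cancel_left]
  simp only [h1]
  rw [lintegral_lintegral_swap]
  · refine lintegral_congr fun g => ?_
    rw [lintegral_lintegral_swap (by fun_prop)]
    refine lintegral_congr fun y => ?_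
    rw [lintegral_mul_const _ (by fun_prop)]
    rfl
  · exact (Measurable.lintegral_prod_right'
      (f := fun q : (A × Γ) × SignalBlock n n₀ => noiseDensity (q.2 - s q.1) * F (q.2, q.1.2))
      (by fun_prop)).aemeasurable

end Mixture


/-! ### The smoothed law of the signal at the first receiver -/

section Smoothed

variable {n n₀ : ℕ} {A Γ : Type*} [MeasurableSpace A] [MeasurableSpace Γ]
  {α : Measure A} [IsProbabilityMeasure α]

/-- The kernel of a block. -/
def blockKernel (y : SignalBlock n n₀) : ENNReal := ∏ t, ∏ j, kernel (y t j)

/-- The taper of a block. -/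
def blockTaper (y : SignalBlock n n₀) : ENNReal := ∏ t, ∏ j, taper (y t j)

@[fun_prop]
theorem measurable_blockKernel : Measurable (blockKernel (n := n) (n₀ := n₀)) := by
  unfold blockKernel; fun_prop

@[fun_prop]
theorem measurable_blockTaper : Measurable (blockTaper (n := n) (n₀ := n₀)) := by
  unfold blockTaper; fun_prop

theorem blockKernel_pos (y : SignalBlock n n₀) : 0 < blockKernel y :=
  CanonicallyOrderedAdd.prod_pos.2 fun _ _ => CanonicallyOrderedAdd.prod_pos.2 fun _ _ =>
    kernel_pos _

theorem blockKernel_le_one (y : SignalBlock n n₀) : blockKernel y ≤ 1 :=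
  Finset.prod_le_one' fun _ _ => Finset.prod_le_one' fun _ _ => kernel_le_one _

theorem blockTaper_pos (y : SignalBlock n n₀) : 0 < blockTaper y :=
  CanonicallyOrderedAdd.prod_pos.2 fun _ _ => CanonicallyOrderedAdd.prod_pos.2 fun _ _ =>
    taper_pos _

theorem blockTaper_ne_top (y : SignalBlock n n₀) : blockTaper y ≠ ⊤ :=
  ENNReal.prod_ne_top fun _ _ => ENNReal.prod_ne_top fun _ _ => ENNReal.ofReal_ne_top

theorem lintegral_blockKernel_sub_mul_blockTaper_le (v : SignalBlock n n₀) :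
    ∫⁻ y, blockKernel (y - v) * blockTaper y ≤ ENNReal.ofReal (2 * taperedMass) ^ (n * n₀) := by
  have h : ∀ y : SignalBlock n n₀, blockKernel (y - v) * blockTaper y =
      ∏ t, ∏ j, kernel (y t j - v t j) * taper (y t j) := fun y => by
    simp only [blockKernel, blockTaper, Finset.prod_mul_distrib, Pi.sub_apply]
  simp only [h]
  rw [volume_pi, lintegral_pi_prod (fun _ : Fin n => (volume : Measure (Fin n₀ → ℂ)))
    (fun t y => ∏ j, kernel (y j - v t j) * taper (y j)) fun t => by fun_prop]
  calc _ ≤ ∏ _ : Fin n, ∏ _ : Fin n₀, ENNReal.ofReal (2 * taperedMass) := by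
        refine Finset.prod_le_prod' fun t _ => ?_
        rw [volume_pi, lintegral_pi_prod (fun _ : Fin n₀ => (volume : Measure ℂ))
          (fun j y => kernel (y - v t j) * taper y) fun j => by fun_prop]
        exact Finset.prod_le_prod' fun j _ => lintegral_kernel_sub_mul_taper_le _
    _ = _ := by simp [← pow_mul, mul_comm n₀ n]

theorem neg_log_blockTaper_le {p : ℝ} (hp : 0 < p) (y : SignalBlock n n₀) :
    -Real.log (blockTaper y).toReal ≤ n * n₀ * (2 * Real.log (1 + Real.log (1 + p)) + 2) +
      2 / (1 + p) * ∑ t, ∑ j, ‖y t j‖ ^ 2 := by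
  have h0 : ∀ w, (taper w).toReal ≠ 0 := fun w =>
    (ENNReal.toReal_pos (taper_pos w).ne' ENNReal.ofReal_ne_top).ne'
  have h1 : -Real.log (blockTaper y).toReal = ∑ t, ∑ j, -Real.log (taper (y t j)).toReal := by
    unfold blockTaper
    simp_rw [ENNReal.toReal_prod]
    rw [Real.log_prod fun t _ => Finset.prod_ne_zero_iff.2 fun j _ => h0 _,
      ← Finset.sum_neg_distrib]
    refine Finset.sum_congr rfl fun t _ => ?_
    rw [Real.log_prod fun j _ => h0 _, ← Finset.sum_neg_distrib]
  rw [h1]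
  calc _ ≤ ∑ t : Fin n, ∑ j : Fin n₀, ((2 * Real.log (1 + Real.log (1 + p)) + 2) +
        2 / (1 + p) * ‖y t j‖ ^ 2) := by
        refine Finset.sum_le_sum fun t _ => Finset.sum_le_sum fun j _ => ?_
        refine (neg_log_taper_le hp _).trans ?_
        have : 2 * ((1 + ‖y t j‖ ^ 2) / (1 + p)) =
          2 * (1 / (1 + p)) + 2 / (1 + p) * ‖y t j‖ ^ 2 := by ring
        have h3 : 1 / (1 + p) ≤ 1 := by rw [div_le_one (by linarith)]; linarith
        linarith
    _ = _ := by
        simp only [Finset.sum_add_distrib, Finset.sum_const, Finset.card_univ, Fintype.card_fin,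
          nsmul_eq_mul, Finset.mul_sum]
        ring

/-- The factor `2 (1 + ‖z‖²)` of the scalar bound is weakened to `exp (log 2 + ‖z‖²)`, so that the
logarithm of the product is linear in the noise power. -/
theorem blockKernel_le_mul_blockKernel_add (u z : SignalBlock n n₀) :
    blockKernel u ≤
      ENNReal.ofReal (Real.exp (∑ t, ∑ j, (Real.log 2 + ‖z t j‖ ^ 2))) * blockKernel (u + z) := by
  have h : ENNReal.ofReal (Real.exp (∑ t, ∑ j, (Real.log 2 + ‖z t j‖ ^ 2))) =
      ∏ t, ∏ j, ENNReal.ofReal (Real.exp (Real.log 2 + ‖z t j‖ ^ 2)) := by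
    simp_rw [Real.exp_sum]
    rw [ENNReal.ofReal_prod_of_nonneg fun t _ => by positivity]
    exact Finset.prod_congr rfl fun t _ => ENNReal.ofReal_prod_of_nonneg fun j _ => by positivity
  rw [h]
  unfold blockKernel
  simp only [← Finset.prod_mul_distrib]
  refine Finset.prod_le_prod' fun t _ => Finset.prod_le_prod' fun j _ => ?_
  refine (kernel_le_mul_kernel_add (u t j) (z t j)).trans (mul_le_mul_left ?_ _)
  refine ENNReal.ofReal_le_ofReal ?_
  rw [Real.exp_add, Real.exp_log (by norm_num)]
  have := Real.add_one_le_exp (‖z t j‖ ^ 2)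
  linarith

/-- The convolution of the conditional law, given `g`, of the signal `s (a, g)` with the block
kernel. -/
def smoothedLaw (α : Measure A) (s : A × Γ → SignalBlock n n₀) (q : SignalBlock n n₀ × Γ) :
    ENNReal :=
  ∫⁻ a, blockKernel (q.1 - s (a, q.2)) ∂α

theorem measurable_smoothedLaw {s : A × Γ → SignalBlock n n₀} (hs : Measurable s) :
    Measurable (smoothedLaw α s) := by
  unfold smoothedLaw
  exact Measurable.lintegral_prod_right'
    (f := fun q : (SignalBlock n n₀ × Γ) × A => blockKernel (q.1.1 - s (q.2, q.1.2)))
    (by fun_prop)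

theorem smoothedLaw_pos {s : A × Γ → SignalBlock n n₀} (hs : Measurable s)
    (q : SignalBlock n n₀ × Γ) : 0 < smoothedLaw α s q :=
  lintegral_pos_of_forall (by fun_prop) fun _ => blockKernel_pos _

theorem smoothedLaw_ne_top {Γ : Type*} (s : A × Γ → SignalBlock n n₀) (q : SignalBlock n n₀ × Γ) :
    smoothedLaw α s q ≠ ⊤ := by
  have h : smoothedLaw α s q ≤ 1 := (lintegral_mono fun _ => blockKernel_le_one _).trans (by simp)
  exact (h.trans_lt ENNReal.one_lt_top).ne

/-- The bridge between the receivers: the second receiver's bound involves the smoothed law at the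
noiseless signal `v`, the first receiver's reference density involves it at the noisy output `v +
z`. -/
theorem log_smoothedLaw_le {s : A × Γ → SignalBlock n n₀} (hs : Measurable s)
    (v z : SignalBlock n n₀) (g : Γ) :
    Real.log (smoothedLaw α s (v, g)).toReal ≤
      ∑ t, ∑ j, (Real.log 2 + ‖z t j‖ ^ 2) + Real.log (smoothedLaw α s (v + z, g)).toReal := by
  have h : smoothedLaw α s (v, g) ≤
      ENNReal.ofReal (Real.exp (∑ t, ∑ j, (Real.log 2 + ‖z t j‖ ^ 2))) *
        smoothedLaw α s (v + z, g) := by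
    unfold smoothedLaw
    rw [← lintegral_const_mul _ (by fun_prop)]
    refine lintegral_mono fun a => ?_
    have := blockKernel_le_mul_blockKernel_add (v - s (a, g)) z
    rwa [sub_add_eq_add_sub] at this
  have h1 : ∀ w, 0 < (smoothedLaw α s (w, g)).toReal := fun w =>
    ENNReal.toReal_pos (smoothedLaw_pos hs _).ne' (smoothedLaw_ne_top s _)
  have h2 := ENNReal.toReal_mono
    (ENNReal.mul_ne_top ENNReal.ofReal_ne_top (smoothedLaw_ne_top s _)) h
  rw [ENNReal.toReal_mul, ENNReal.toReal_ofReal (Real.exp_pos _).le] at h2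
  have h3 := Real.log_le_log (h1 v) h2
  rwa [Real.log_mul (Real.exp_pos _).ne' (h1 _).ne', Real.log_exp] at h3

/-- The reference density for the first receiver: the tapered and normalised smoothed law. -/
def reference (α : Measure A) (s : A × Γ → SignalBlock n n₀) (q : SignalBlock n n₀ × Γ) :
    ENNReal :=
  (ENNReal.ofReal (2 * taperedMass) ^ (n * n₀))⁻¹ * (smoothedLaw α s q * blockTaper q.1)

theorem measurable_reference {s : A × Γ → SignalBlock n n₀} (hs : Measurable s) :
    Measurable (reference α s) := by
  have := measurable_smoothedLaw (α := α) hs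
  unfold reference; fun_prop

theorem lintegral_reference_le_one {s : A × Γ → SignalBlock n n₀} (hs : Measurable s) (g : Γ) :
    ∫⁻ y, reference α s (y, g) ≤ 1 := by
  have hm := measurable_smoothedLaw (α := α) hs
  have hk : Measurable fun q : SignalBlock n n₀ × A =>
      blockKernel (q.1 - s (q.2, g)) * blockTaper q.1 := by fun_prop
  unfold reference
  rw [lintegral_const_mul _ (by fun_prop), mul_comm, ← div_eq_mul_inv]
  refine ENNReal.div_le_of_le_mul ?_
  rw [one_mul]
  have h1 : ∀ y, smoothedLaw α s (y, g) * blockTaper y =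
      ∫⁻ a, blockKernel (y - s (a, g)) * blockTaper y ∂α := fun y => by
    rw [lintegral_mul_const _ (by fun_prop)]; rfl
  simp only [h1]
  -- The taper depends on `y` alone, so for each source value the bound uniform in the shift `s (a,
  -- g)` applies.
  rw [lintegral_lintegral_swap hk.aemeasurable]
  exact (lintegral_mono fun a => lintegral_blockKernel_sub_mul_blockTaper_le _).trans (by simp)

theorem reference_pos {s : A × Γ → SignalBlock n n₀} (hs : Measurable s)
    (q : SignalBlock n n₀ × Γ) : 0 < reference α s q := by
  refine ENNReal.mul_pos ?_ ?_
  · exact ENNReal.inv_ne_zero.2 (ENNReal.pow_ne_top ENNReal.ofReal_ne_top)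
  · exact mul_ne_zero (smoothedLaw_pos hs q).ne' (blockTaper_pos _).ne'

theorem reference_ne_top {Γ : Type*} (s : A × Γ → SignalBlock n n₀) (q : SignalBlock n n₀ × Γ) :
    reference α s q ≠ ⊤ := by
  refine ENNReal.mul_ne_top (ENNReal.inv_ne_top.2 (pow_ne_zero _ ?_))
    (ENNReal.mul_ne_top (smoothedLaw_ne_top s q) (blockTaper_ne_top _))
  exact (ENNReal.ofReal_pos.2 (mul_pos two_pos taperedMass_pos)).ne'

theorem neg_log_reference {s : A × Γ → SignalBlock n n₀} (hs : Measurable s)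
    (q : SignalBlock n n₀ × Γ) :
    -Real.log (reference α s q).toReal = n * n₀ * Real.log (2 * taperedMass) -
      Real.log (smoothedLaw α s q).toReal - Real.log (blockTaper q.1).toReal := by
  have hB : 0 < 2 * taperedMass := mul_pos two_pos taperedMass_pos
  have h1 := (ENNReal.toReal_pos (smoothedLaw_pos (α := α) hs q).ne' (smoothedLaw_ne_top s q)).ne'
  have h2 := (ENNReal.toReal_pos (blockTaper_pos q.1).ne' (blockTaper_ne_top q.1)).ne'
  rw [reference, ENNReal.toReal_mul, ENNReal.toReal_mul, ENNReal.toReal_inv, ENNReal.toReal_pow,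
    ENNReal.toReal_ofReal hB.le, Real.log_mul (inv_ne_zero (pow_ne_zero _ hB.ne'))
    (mul_ne_zero h1 h2), Real.log_mul h1 h2, Real.log_inv, Real.log_pow]
  push_cast
  ring

end Smoothed


/-! ### The code as a signal in Gaussian noise -/

theorem sum_sq_norm_channelOutput_le {n n₀ m : ℕ} {dmax : ℝ} (g : ChannelBlock n n₀ m)
    (x : Fin n → Fin m → ℂ) (z : SignalBlock n n₀) (hg : ∀ t j i, ‖g t j i‖ ≤ dmax) :
    ∑ t, ∑ j, ‖channelOutput g x z t j‖ ^ 2 ≤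
      2 * n₀ * m * dmax ^ 2 * ∑ t, ∑ i, ‖x t i‖ ^ 2 + 2 * ∑ t, ∑ j, ‖z t j‖ ^ 2 := by
  have h : ∀ t j, ‖channelOutput g x z t j‖ ^ 2 ≤
      2 * m * dmax ^ 2 * ∑ i, ‖x t i‖ ^ 2 + 2 * ‖z t j‖ ^ 2 := fun t j => by
    have h1 : ‖∑ i, g t j i * x t i‖ ^ 2 ≤ m * dmax ^ 2 * ∑ i, ‖x t i‖ ^ 2 := by
      calc ‖∑ i, g t j i * x t i‖ ^ 2 ≤ (∑ i, ‖g t j i * x t i‖) ^ 2 := by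
            gcongr; exact norm_sum_le _ _
        _ ≤ m * ∑ i, ‖g t j i * x t i‖ ^ 2 := by
            simpa using sq_sum_le_card_mul_sum_sq (s := Finset.univ)
              (f := fun i => ‖g t j i * x t i‖)
        _ ≤ m * ∑ i, dmax ^ 2 * ‖x t i‖ ^ 2 := by
            gcongr with i
            rw [norm_mul, mul_pow]
            gcongr
            exact hg t j i
        _ = _ := by rw [← Finset.mul_sum, mul_assoc]
    calc ‖channelOutput g x z t j‖ ^ 2 ≤ (‖∑ i, g t j i * x t i‖ + ‖z t j‖) ^ 2 := by
          gcongr; exact norm_add_le _ _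
      _ ≤ 2 * (‖∑ i, g t j i * x t i‖ ^ 2 + ‖z t j‖ ^ 2) := add_sq_le
      _ ≤ _ := by linarith
  calc _ ≤ ∑ t, ∑ j : Fin n₀, (2 * m * dmax ^ 2 * ∑ i, ‖x t i‖ ^ 2 + 2 * ‖z t j‖ ^ 2) :=
        Finset.sum_le_sum fun t _ => Finset.sum_le_sum fun j _ => h t j
    _ = _ := by
        simp only [Finset.sum_add_distrib, Finset.sum_const, Finset.card_univ, Fintype.card_fin,
          nsmul_eq_mul, ← Finset.mul_sum]
        ring

theorem integrable_of_lintegral_ofReal_le {Ω : Type*} [MeasurableSpace Ω] {P : Measure Ω}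
    {f : Ω → ℝ} (hf : Measurable f) (h0 : ∀ ω, 0 ≤ f ω) {b : ℝ} (hb : 0 ≤ b)
    (h : ∫⁻ ω, ENNReal.ofReal (f ω) ∂P ≤ ENNReal.ofReal b) :
    Integrable f P ∧ ∫ ω, f ω ∂P ≤ b := by
  constructor
  · refine ⟨hf.aestronglyMeasurable, ?_⟩
    rw [hasFiniteIntegral_iff_ofReal (Eventually.of_forall h0)]
    exact h.trans_lt ENNReal.ofReal_lt_top
  · rw [integral_eq_lintegral_of_nonneg_ae (Eventually.of_forall h0) hf.aestronglyMeasurable]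
    exact ENNReal.toReal_le_of_le_ofReal hb h

theorem integrable_noisePower {n n₀ : ℕ} {Ω : Type*} [MeasurableSpace Ω] {P : Measure Ω}
    {z : Ω → SignalBlock n n₀} (h : MeasurePreserving z P (noiseLaw n n₀)) :
    Integrable (fun ω => ∑ t, ∑ j, ‖z ω t j‖ ^ 2) P ∧
      ∫ ω, ∑ t, ∑ j, ‖z ω t j‖ ^ 2 ∂P ≤ n * n₀ := by
  have hz := h.measurable
  refine integrable_of_lintegral_ofReal_le (by fun_prop) (fun ω => by positivity) (by positivity)
    ?_
  rw [h.lintegral_comp (f := fun z => ENNReal.ofReal (∑ t, ∑ j, ‖z t j‖ ^ 2)) (by fun_prop),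
    lintegral_sum_sq_norm_noiseLaw]
  rw [ENNReal.ofReal_mul (by positivity), ENNReal.ofReal_natCast, ENNReal.ofReal_natCast]

/-- The law of message and private randomness. -/
def sourceLaw (M : ℕ) {U : Type*} [MeasurableSpace U] (μU : Measure U) : Measure (Fin M × U) :=
  (uniformOn (Set.univ : Set (Fin M))).prod μU

theorem isProbabilityMeasure_uniformOn_fin {M : ℕ} (hM : 0 < M) :
    IsProbabilityMeasure (uniformOn (Set.univ : Set (Fin M))) := by
  have : Nonempty (Fin M) := ⟨⟨0, hM⟩⟩
  exact isProbabilityMeasure_uniformOn Set.finite_univ Set.univ_nonempty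

theorem isProbabilityMeasure_sourceLaw {M : ℕ} (hM : 0 < M) {U : Type*} [MeasurableSpace U]
    (μU : Measure U) [IsProbabilityMeasure μU] : IsProbabilityMeasure (sourceLaw M μU) := by
  have := isProbabilityMeasure_uniformOn_fin hM
  unfold sourceLaw; infer_instance

/-- The law of all channel coefficients. -/
def channelLaw {n n₀ m : ℕ} {dmax f : ℝ} (laws : CoefLaws n n₀ m dmax f) :
    Measure (ChannelBlock n n₀ m × ChannelBlock n n₀ m) :=
  (blockLaw laws.law₁).prod (blockLaw laws.law₂)

section

variable {n n₀ m : ℕ} {dmax f : ℝ} (laws : CoefLaws n n₀ m dmax f)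

instance : IsProbabilityMeasure (blockLaw laws.law₁) := isProbabilityMeasure_blockLaw laws.isProb₁

instance : IsProbabilityMeasure (blockLaw laws.law₂) := isProbabilityMeasure_blockLaw laws.isProb₂

instance : IsProbabilityMeasure (channelLaw laws) := by unfold channelLaw; infer_instance

variable {M : ℕ} {U : Type*} [MeasurableSpace U] (μU : Measure U) [IsProbabilityMeasure μU]

/-- Source, channels and both noise blocks are independent. -/
theorem measurePreserving_source_channel_noise (hM : 0 < M) :
    MeasurePreserving
      (fun ω : Outcome n n₀ m M U => ((ω.1, ω.2.1), ω.2.2.1, ω.2.2.2)) (outcomeLaw laws M μU)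
      ((sourceLaw M μU).prod ((channelLaw laws).prod
        ((noiseLaw n n₀).prod (noiseLaw n n₀)))) := by
  have := isProbabilityMeasure_uniformOn_fin hM
  exact (measurePreserving_prodAssoc (uniformOn (Set.univ : Set (Fin M))) μU
    ((channelLaw laws).prod ((noiseLaw n n₀).prod (noiseLaw n n₀)))).symm

theorem measurePreserving_noise₁ (hM : 0 < M) :
    MeasurePreserving
      (fun ω : Outcome n n₀ m M U => ((ω.1, ω.2.1), ω.2.2.1, ω.2.2.2.1)) (outcomeLaw laws M μU)
      ((sourceLaw M μU).prod ((channelLaw laws).prod (noiseLaw n n₀))) := by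
  have := isProbabilityMeasure_sourceLaw hM μU
  exact ((MeasurePreserving.id _).prod ((MeasurePreserving.id _).prod
    measurePreserving_fst)).comp (measurePreserving_source_channel_noise laws μU hM)

theorem measurePreserving_noise₂ (hM : 0 < M) :
    MeasurePreserving
      (fun ω : Outcome n n₀ m M U => ((ω.1, ω.2.1), ω.2.2.1, ω.2.2.2.2)) (outcomeLaw laws M μU)
      ((sourceLaw M μU).prod ((channelLaw laws).prod (noiseLaw n n₀))) := by
  have := isProbabilityMeasure_sourceLaw hM μU
  exact ((MeasurePreserving.id _).prod ((MeasurePreserving.id _).prod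
    measurePreserving_snd)).comp (measurePreserving_source_channel_noise laws μU hM)

theorem measurePreserving_channels (hM : 0 < M) :
    MeasurePreserving (channels : Outcome n n₀ m M U → _) (outcomeLaw laws M μU)
      (channelLaw laws) := by
  have := isProbabilityMeasure_sourceLaw hM μU
  have h : MeasurePreserving
      (fun q : (Fin M × U) × (ChannelBlock n n₀ m × ChannelBlock n n₀ m) × SignalBlock n n₀ =>
        q.2.1) ((sourceLaw M μU).prod ((channelLaw laws).prod (noiseLaw n n₀)))
      (channelLaw laws) := measurePreserving_fst.comp measurePreserving_snd
  exact h.comp (measurePreserving_noise₁ laws μU hM)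

theorem isProbabilityMeasure_outcomeLaw (hM : 0 < M) :
    IsProbabilityMeasure (outcomeLaw laws M μU) := by
  have := isProbabilityMeasure_uniformOn_fin hM
  unfold outcomeLaw; infer_instance

theorem ae_channels_bounded (hM : 0 < M) :
    ∀ᵐ ω ∂(outcomeLaw laws M μU), (∀ t j i, ‖(channels ω).1 t j i‖ ≤ dmax) ∧
      ∀ t j i, ‖(channels ω).2 t j i‖ ≤ dmax := by
  refine (measurePreserving_channels laws μU hM).quasiMeasurePreserving.ae
    (p := fun g => (∀ t j i, ‖g.1 t j i‖ ≤ dmax) ∧ ∀ t j i, ‖g.2 t j i‖ ≤ dmax) ?_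
  exact (measurePreserving_fst.quasiMeasurePreserving.ae
    (ae_blockLaw laws.isProb₁ laws.bounded₁)).and
    (measurePreserving_snd.quasiMeasurePreserving.ae (ae_blockLaw laws.isProb₂ laws.bounded₂))

end

namespace Code

variable {n n₀ m M : ℕ} {U : Type*} [MeasurableSpace U] {K : Fin n → Set (Fin n)}

/-- The transmitted block as a function of source and first channel. -/
def codeword (c : Code n n₀ m M U K) (a : Fin M × U) (g : ChannelBlock n n₀ m) :
    Fin n → Fin m → ℂ :=
  fun t => c.enc t a.1 a.2 g

/-- The noiseless reception at the first receiver. -/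
def signal₁ (c : Code n n₀ m M U K)
    (q : (Fin M × U) × ChannelBlock n n₀ m × ChannelBlock n n₀ m) : SignalBlock n n₀ :=
  received q.2.1 (c.codeword q.1 q.2.1)

/-- The noiseless reception at the second receiver. -/
def signal₂ (c : Code n n₀ m M U K)
    (q : (Fin M × U) × ChannelBlock n n₀ m × ChannelBlock n n₀ m) : SignalBlock n n₀ :=
  received q.2.2 (c.codeword q.1 q.2.1)

theorem measurable_codeword (c : Code n n₀ m M U K) :
    Measurable fun q : (Fin M × U) × ChannelBlock n n₀ m => c.codeword q.1 q.2 := by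
  have h : Measurable fun q : Fin M × U × ChannelBlock n n₀ m =>
      fun t => c.enc t q.1 q.2.1 q.2.2 :=
    measurable_from_prod_countable_right fun w => measurable_pi_lambda _ fun t =>
      c.measurable_enc t w
  exact h.comp (MeasurableEquiv.prodAssoc (α := Fin M) (β := U)).measurable

theorem measurable_received :
    Measurable fun q : ChannelBlock n n₀ m × (Fin n → Fin m → ℂ) => received q.1 q.2 := by
  unfold received; fun_prop

theorem measurable_signal₁ (c : Code n n₀ m M U K) : Measurable c.signal₁ :=
  measurable_received.comp (measurable_snd.fst.prodMk
    (c.measurable_codeword.comp (measurable_fst.prodMk measurable_snd.fst)))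

theorem measurable_signal₂ (c : Code n n₀ m M U K) : Measurable c.signal₂ :=
  measurable_received.comp (measurable_snd.snd.prodMk
    (c.measurable_codeword.comp (measurable_fst.prodMk measurable_snd.fst)))

theorem output₁_eq (c : Code n n₀ m M U K) (ω : Outcome n n₀ m M U) :
    c.output₁ ω = c.signal₁ ((ω.1, ω.2.1), channels ω) + ω.2.2.2.1 := rfl

theorem output₂_eq (c : Code n n₀ m M U K) (ω : Outcome n n₀ m M U) :
    c.output₂ ω = c.signal₂ ((ω.1, ω.2.1), channels ω) + ω.2.2.2.2 := rfl

theorem measurable_channels : Measurable (channels : Outcome n n₀ m M U → _) := by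
  unfold channels; fun_prop

theorem measurable_output₁ (c : Code n n₀ m M U K) : Measurable c.output₁ := by
  have := c.measurable_signal₁
  have := measurable_channels (n := n) (n₀ := n₀) (m := m) (M := M) (U := U)
  simp only [funext c.output₁_eq]
  fun_prop

theorem measurable_output₂ (c : Code n n₀ m M U K) : Measurable c.output₂ := by
  have := c.measurable_signal₂
  have := measurable_channels (n := n) (n₀ := n₀) (m := m) (M := M) (U := U)
  simp only [funext c.output₂_eq]
  fun_prop

theorem measurable_input (c : Code n n₀ m M U K) : Measurable c.input := by
  have h := c.measurable_codeword
  have h2 : Measurable fun ω : Outcome n n₀ m M U => ((ω.1, ω.2.1), ω.2.2.1.1) := by fun_prop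
  exact h.comp h2

variable {dmax f : ℝ} (laws : CoefLaws n n₀ m dmax f) (μU : Measure U)

theorem integrable_inputPower (c : Code n n₀ m M U K) {p : ℝ} (hp : 0 < p)
    (h : c.PowerConstraint (outcomeLaw laws M μU) p) :
    Integrable (fun ω => ∑ t, ∑ i, ‖c.input ω t i‖ ^ 2) (outcomeLaw laws M μU) ∧
      ∫ ω, ∑ t, ∑ i, ‖c.input ω t i‖ ^ 2 ∂(outcomeLaw laws M μU) ≤ n * p := by
  have := c.measurable_input
  refine integrable_of_lintegral_ofReal_le (by fun_prop) (fun ω => by positivity) (by positivity)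
    ?_
  rw [ENNReal.ofReal_mul (by positivity), ENNReal.ofReal_natCast]
  refine le_trans (le_of_eq ?_) h
  refine lintegral_congr fun ω => ?_
  rw [ENNReal.ofReal_sum_of_nonneg fun t _ => by positivity]
  refine Finset.sum_congr rfl fun t _ => ?_
  rw [ENNReal.ofReal_sum_of_nonneg fun t _ => by positivity]
  refine Finset.sum_congr rfl fun i _ => ?_
  rw [ENNReal.ofReal_pow (norm_nonneg _), ofReal_norm]

/-- Stated for arbitrary `g`, `z` and `Y` so as to serve both receivers. Input and noise powers are
bounded separately through `(a + b)² ≤ 2 (a² + b²)`, so no independence enters. -/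
theorem integrable_outputPower (c : Code n n₀ m M U K) {p : ℝ} (hp : 0 < p)
    (h : c.PowerConstraint (outcomeLaw laws M μU) p)
    {g : Outcome n n₀ m M U → ChannelBlock n n₀ m} {Y z : Outcome n n₀ m M U → SignalBlock n n₀}
    (hY : ∀ ω, Y ω = channelOutput (g ω) (c.input ω) (z ω)) (hYm : Measurable Y)
    (hg : ∀ᵐ ω ∂(outcomeLaw laws M μU), ∀ t j i, ‖g ω t j i‖ ≤ dmax)
    (hz : MeasurePreserving z (outcomeLaw laws M μU) (noiseLaw n n₀)) :
    Integrable (fun ω => ∑ t, ∑ j, ‖Y ω t j‖ ^ 2) (outcomeLaw laws M μU) ∧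
      ∫ ω, ∑ t, ∑ j, ‖Y ω t j‖ ^ 2 ∂(outcomeLaw laws M μU) ≤
        n * n₀ * (2 * m * dmax ^ 2 * p + 2) := by
  obtain ⟨hx1, hx2⟩ := c.integrable_inputPower laws μU hp h
  obtain ⟨hz1, hz2⟩ := integrable_noisePower hz
  have hI := (hx1.const_mul (2 * n₀ * m * dmax ^ 2)).add (hz1.const_mul 2)
  have hle : ∀ᵐ ω ∂(outcomeLaw laws M μU), ∑ t, ∑ j, ‖Y ω t j‖ ^ 2 ≤
      2 * n₀ * m * dmax ^ 2 * ∑ t, ∑ i, ‖c.input ω t i‖ ^ 2 + 2 * ∑ t, ∑ j, ‖z ω t j‖ ^ 2 := by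
    filter_upwards [hg] with ω hω
    rw [hY]
    exact sum_sq_norm_channelOutput_le _ _ _ hω
  have hYI : Integrable (fun ω => ∑ t, ∑ j, ‖Y ω t j‖ ^ 2) (outcomeLaw laws M μU) := by
    refine hI.mono' (by fun_prop) ?_
    filter_upwards [hle] with ω hω
    rw [Real.norm_of_nonneg (by positivity)]
    exact hω
  refine ⟨hYI, ?_⟩
  calc _ ≤ ∫ ω, (2 * n₀ * m * dmax ^ 2 * ∑ t, ∑ i, ‖c.input ω t i‖ ^ 2 +
          2 * ∑ t, ∑ j, ‖z ω t j‖ ^ 2) ∂(outcomeLaw laws M μU) := integral_mono_ae hYI hI hle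
    _ = 2 * n₀ * m * dmax ^ 2 * ∫ ω, ∑ t, ∑ i, ‖c.input ω t i‖ ^ 2 ∂(outcomeLaw laws M μU) +
          2 * ∫ ω, ∑ t, ∑ j, ‖z ω t j‖ ^ 2 ∂(outcomeLaw laws M μU) := by
        rw [integral_add (hx1.const_mul _) (hz1.const_mul _), integral_const_mul,
          integral_const_mul]
    _ ≤ 2 * n₀ * m * dmax ^ 2 * (n * p) + 2 * (n * n₀) := by gcongr
    _ = _ := by ring

end Code

/-- A signal of finite power in Gaussian noise has finite conditional differential entropy. -/
theorem entropy_signal_add_noise {n n₀ : ℕ} {Ω A Γ : Type*} [MeasurableSpace Ω]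
    [MeasurableSpace A] [MeasurableSpace Γ] {P : Measure Ω} {α : Measure A}
    [IsProbabilityMeasure α] [IsProbabilityMeasure P]
    {γ : Measure Γ} [IsProbabilityMeasure γ] {a : Ω → A} {G : Ω → Γ} {z : Ω → SignalBlock n n₀}
    (h : MeasurePreserving (fun ω => (a ω, G ω, z ω)) P (α.prod (γ.prod (noiseLaw n n₀))))
    (hG : MeasurePreserving G P γ)
    {s : A × Γ → SignalBlock n n₀} (hs : Measurable s)
    {Y : Ω → SignalBlock n n₀} (hYm : Measurable Y) (hY : ∀ ω, Y ω = s (a ω, G ω) + z ω)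
    (hint : Integrable (fun ω => ∑ t, ∑ j, ‖Y ω t j‖ ^ 2) P) :
    HasCondDiffEntropy P Y G ∧
      Integrable (fun ω => Real.log (mixtureDensity α s (Y ω, G ω)).toReal) P ∧
      condDiffEntropy P Y G = -∫ ω, Real.log (mixtureDensity α s (Y ω, G ω)).toReal ∂P ∧
      ∀ r : SignalBlock n n₀ × Γ → ENNReal, Measurable r → (∀ g, ∫⁻ y, r (y, g) ≤ 1) →
        ∫⁻ ω, r (Y ω, G ω) / mixtureDensity α s (Y ω, G ω) ∂P ≤ 1 := by
  have hρ := measurable_mixtureDensity (α := α) hs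
  have hmap : (P.map fun ω => (Y ω, G ω)) =
      ((volume : Measure (SignalBlock n n₀)).prod γ).withDensity (mixtureDensity α s) := by
    simp only [hY]
    exact map_signal_add_noise h hs
  -- The Gaussian density serves as the comparison density: its logarithm is affine in the output
  -- power, which is integrable.
  have hlog : Integrable (fun ω => Real.log (noiseDensity (Y ω)).toReal) P := by
    have : (fun ω => Real.log (noiseDensity (Y ω)).toReal) =
        -fun ω => (n * n₀ * Real.log Real.pi + ∑ t, ∑ j, ‖Y ω t j‖ ^ 2) := by
      funext ω
      rw [Pi.neg_apply, ← neg_eq_iff_eq_neg, neg_log_noiseDensity]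
      simp [Finset.sum_add_distrib, mul_assoc]
    rw [this]
    exact ((integrable_const _).add hint).neg
  have hI := integrable_log_density hYm hG.measurable hρ hmap (mixtureDensity_pos hs)
    (mixtureDensity_le_one s) measurable_noiseDensity noiseDensity_pos
    (fun y => ((noiseDensity_le_one y).trans_lt ENNReal.one_lt_top).ne)
    (lintegral_noiseDensity n n₀).le hlog
  refine ⟨⟨?_, ?_⟩, hI, condDiffEntropy_eq hYm hG.measurable hρ hG.map_eq hmap,
    fun r hr hr1 => lintegral_div_density_le_one hYm hG.measurable hρ hmap hr hr1⟩
  · rw [hmap, hG.map_eq]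
    exact withDensity_absolutelyContinuous _ _
  · refine hI.congr ?_
    filter_upwards [condDensity_ae_eq hYm hG.measurable hρ hG.map_eq hmap] with ω hω
    rw [hω]


/-! ### Alignment at the second receiver -/

theorem received_sub {n n₀ m : ℕ} (g : ChannelBlock n n₀ m) (x x' : Fin n → Fin m → ℂ) :
    received g (x - x') = received g x - received g x' := by
  funext t j
  simp [received, mul_sub]

/-- The error term per channel use and receive antenna. -/
def alignmentLoss (m : ℕ) (dmax p : ℝ) : ℝ :=
  Real.log (dmax ^ 2 * (1 + m ^ 2)) + Real.log (2 * taperedMass) + Real.log 2 + 7 +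
    4 * m * dmax ^ 2 + 2 * Real.log (1 + Real.log (1 + p))

namespace Code

variable {n n₀ m M : ℕ} {U : Type*} [MeasurableSpace U] {K : Fin n → Set (Fin n)}
  {dmax f : ℝ} (laws : CoefLaws n n₀ m dmax f) (μU : Measure U) [IsProbabilityMeasure μU]

/-- The expected density at the second receiver, given the input and the first channel, is
controlled by the smoothed law at the first receiver. -/
theorem lintegral_mixtureDensity_le (hM : 0 < M) (hm : 1 ≤ m) (c : Code n n₀ m M U K)
    (a : Fin M × U) (g₁ : ChannelBlock n n₀ m) (hg : ∀ t j i, ‖g₁ t j i‖ ≤ dmax) :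
    ∫⁻ g₂, ∫⁻ z, mixtureDensity (sourceLaw M μU) c.signal₂
        (c.signal₂ (a, g₁, g₂) + z, g₁, g₂) ∂(noiseLaw n n₀) ∂(blockLaw laws.law₂) ≤
      ENNReal.ofReal (f * dmax ^ 2 * (1 + m ^ 2)) ^ (n * n₀) *
        ∫⁻ a', blockKernel (c.signal₁ (a, g₁, g₁) - c.signal₁ (a', g₁, g₁))
          ∂(sourceLaw M μU) := by
  have := isProbabilityMeasure_sourceLaw hM μU
  have hs := c.measurable_signal₁
  have hs₂ := c.measurable_signal₂
  have hmeas : Measurable fun q : (ChannelBlock n n₀ m × (Fin M × U)) × SignalBlock n n₀ =>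
      noiseDensity (c.signal₂ (a, g₁, q.1.1) + q.2 - c.signal₂ (q.1.2, g₁, q.1.1)) := by
    fun_prop
  have hswap : ∀ g₂, ∫⁻ z, mixtureDensity (sourceLaw M μU) c.signal₂
        (c.signal₂ (a, g₁, g₂) + z, g₁, g₂) ∂(noiseLaw n n₀) =
      ∫⁻ a', ∫⁻ z, noiseDensity (c.signal₂ (a, g₁, g₂) + z - c.signal₂ (a', g₁, g₂))
        ∂(noiseLaw n n₀) ∂(sourceLaw M μU) := fun g₂ => by
    unfold mixtureDensity
    rw [lintegral_lintegral_swap (by fun_prop)]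
  simp only [hswap]
  rw [lintegral_lintegral_swap hmeas.lintegral_prod_right'.aemeasurable,
    ← lintegral_const_mul _ (by fun_prop)]
  refine lintegral_mono fun a' => ?_
  -- Given `g₁`, both codewords are fixed before `g₂` is drawn, so their difference is a legitimate
  -- deterministic `d`.
  have h := lintegral_noiseDensity_le_kernel hm laws.isProb₂ laws.density₂ laws.bounded₂
    (c.codeword a g₁ - c.codeword a' g₁) g₁ hg
  simp only [received_sub] at h
  refine le_trans (le_of_eq ?_) h
  refine lintegral_congr fun g₂ => lintegral_congr fun z => ?_
  simp only [signal₂]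
  congr 1
  abel

/-- The denominator depends only on the source and the first channel. Averaging over the second
channel and its noise therefore acts on the numerator alone, where `lintegral_mixtureDensity_le`
bounds it by the denominator. -/
theorem lintegral_div_smoothedLaw_le_one (hM : 0 < M) (hm : 1 ≤ m) (c : Code n n₀ m M U K) :
    ∫⁻ ω, mixtureDensity (sourceLaw M μU) c.signal₂ (c.output₂ ω, channels ω) /
      (ENNReal.ofReal (f * dmax ^ 2 * (1 + m ^ 2)) ^ (n * n₀) *
        smoothedLaw (sourceLaw M μU) c.signal₁
          (c.signal₁ ((ω.1, ω.2.1), channels ω), channels ω)) ∂(outcomeLaw laws M μU) ≤ 1 := by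
  have := isProbabilityMeasure_sourceLaw hM μU
  have hs₁ := c.measurable_signal₁
  have hs₂ := c.measurable_signal₂
  have hρ := measurable_mixtureDensity (α := sourceLaw M μU) hs₂
  have hκ := measurable_smoothedLaw (α := sourceLaw M μU) hs₁
  set C := ENNReal.ofReal (f * dmax ^ 2 * (1 + m ^ 2)) ^ (n * n₀)
  have hF : Measurable fun q : (Fin M × U) × (ChannelBlock n n₀ m × ChannelBlock n n₀ m) ×
      SignalBlock n n₀ => mixtureDensity (sourceLaw M μU) c.signal₂
        (c.signal₂ (q.1, q.2.1) + q.2.2, q.2.1) /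
      (C * smoothedLaw (sourceLaw M μU) c.signal₁ (c.signal₁ (q.1, q.2.1), q.2.1)) := by
    fun_prop
  refine ((measurePreserving_noise₂ laws μU hM).lintegral_comp hF).trans_le ?_
  rw [lintegral_prod _ hF.aemeasurable]
  calc _ ≤ ∫⁻ _, 1 ∂(sourceLaw M μU) := lintegral_mono fun a => ?_
    _ = 1 := by simp
  rw [lintegral_prod _ (by fun_prop)]
  unfold channelLaw
  rw [lintegral_prod]
  swap
  · exact (Measurable.lintegral_prod_right' (f := fun q : (ChannelBlock n n₀ m ×
      ChannelBlock n n₀ m) × SignalBlock n n₀ => mixtureDensity (sourceLaw M μU) c.signal₂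
        (c.signal₂ (a, q.1) + q.2, q.1) /
      (C * smoothedLaw (sourceLaw M μU) c.signal₁ (c.signal₁ (a, q.1), q.1)))
      (by fun_prop)).aemeasurable
  calc _ ≤ ∫⁻ _, 1 ∂(blockLaw laws.law₁) := lintegral_mono_ae ?_
    _ = 1 := by simp
  filter_upwards [ae_blockLaw laws.isProb₁ laws.bounded₁] with g₁ hg₁
  have hle := c.lintegral_mixtureDensity_le laws μU hM hm a g₁ hg₁
  set κ := C * ∫⁻ a', blockKernel (c.signal₁ (a, g₁, g₁) - c.signal₁ (a', g₁, g₁))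
    ∂(sourceLaw M μU)
  calc _ = (∫⁻ g₂, ∫⁻ z, mixtureDensity (sourceLaw M μU) c.signal₂
        (c.signal₂ (a, g₁, g₂) + z, g₁, g₂) ∂(noiseLaw n n₀) ∂(blockLaw laws.law₂)) / κ := by
        have hmm : Measurable fun q : ChannelBlock n n₀ m × SignalBlock n n₀ =>
          mixtureDensity (sourceLaw M μU) c.signal₂
            (c.signal₂ (a, g₁, q.1) + q.2, g₁, q.1) := by fun_prop
        rw [div_eq_mul_inv, ← lintegral_mul_const _ hmm.lintegral_prod_right']
        refine lintegral_congr fun g₂ => ?_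
        rw [← lintegral_mul_const _ (by fun_prop)]
        rfl
    _ ≤ κ / κ := ENNReal.div_le_div_right hle _
    _ ≤ 1 := ENNReal.div_self_le_one

/-- All comparisons are made pointwise in `ω` and integrated once. The likelihood ratios `R₁` and
`R₂` left by the two uses of Gibbs' inequality have expectation at most one. -/
theorem entropy_le (hm : 1 ≤ m) (hn₀ : 1 ≤ n₀) (hM : 0 < M) (c : Code n n₀ m M U K) {p : ℝ}
    (hp : 0 < p) (h : c.PowerConstraint (outcomeLaw laws M μU) p) :
    HasCondDiffEntropy (outcomeLaw laws M μU) c.output₁ channels ∧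
      HasCondDiffEntropy (outcomeLaw laws M μU) c.output₂ channels ∧
      condDiffEntropy (outcomeLaw laws M μU) c.output₁ channels ≤
        condDiffEntropy (outcomeLaw laws M μU) c.output₂ channels +
          n * n₀ * Real.log f + n * n₀ * alignmentLoss m dmax p := by
  have := isProbabilityMeasure_sourceLaw hM μU
  have := isProbabilityMeasure_outcomeLaw laws μU hM
  have hs₁ := c.measurable_signal₁
  have hz₁ : MeasurePreserving (fun ω : Outcome n n₀ m M U => ω.2.2.2.1)
      (outcomeLaw laws M μU) (noiseLaw n n₀) :=
    (measurePreserving_snd.comp (measurePreserving_snd (μ := sourceLaw M μU))).comp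
      (measurePreserving_noise₁ laws μU hM)
  have hz₂ : MeasurePreserving (fun ω : Outcome n n₀ m M U => ω.2.2.2.2)
      (outcomeLaw laws M μU) (noiseLaw n n₀) :=
    (measurePreserving_snd.comp (measurePreserving_snd (μ := sourceLaw M μU))).comp
      (measurePreserving_noise₂ laws μU hM)
  have hb := ae_channels_bounded laws μU hM
  obtain ⟨hY₁, hY₁le⟩ := c.integrable_outputPower laws μU hp h
    (g := fun ω => (channels ω).1) (Y := c.output₁) (fun _ => rfl) c.measurable_output₁ (hb.mono fun _ h => h.1) hz₁
  obtain ⟨hY₂, -⟩ := c.integrable_outputPower laws μU hp h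
    (g := fun ω => (channels ω).2) (Y := c.output₂) (fun _ => rfl) c.measurable_output₂ (hb.mono fun _ h => h.2) hz₂
  obtain ⟨hH₁, hI₁, hE₁, hG₁⟩ := entropy_signal_add_noise (Y := c.output₁) (G := channels)
    (measurePreserving_noise₁ laws μU hM) (measurePreserving_channels laws μU hM) hs₁
    c.measurable_output₁ c.output₁_eq hY₁
  obtain ⟨hH₂, hI₂, hE₂, -⟩ := entropy_signal_add_noise (Y := c.output₂) (G := channels)
    (measurePreserving_noise₂ laws μU hM) (measurePreserving_channels laws μU hM)
    c.measurable_signal₂ c.measurable_output₂ c.output₂_eq hY₂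
  refine ⟨hH₁, hH₂, ?_⟩
  set P := outcomeLaw laws M μU
  obtain ⟨hZ, hZle⟩ := integrable_noisePower hz₁
  set α := sourceLaw M μU
  set A := f * dmax ^ 2 * (1 + m ^ 2) with hA
  set R₁ : Outcome n n₀ m M U → ENNReal := fun ω =>
    reference α c.signal₁ (c.output₁ ω, channels ω) /
      mixtureDensity α c.signal₁ (c.output₁ ω, channels ω)
  set R₂ : Outcome n n₀ m M U → ENNReal := fun ω =>
    mixtureDensity α c.signal₂ (c.output₂ ω, channels ω) /
      (ENNReal.ofReal A ^ (n * n₀) *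
        smoothedLaw α c.signal₁ (c.signal₁ ((ω.1, ω.2.1), channels ω), channels ω))
  have hm₁ : Measurable R₁ := by
    have := measurable_mixtureDensity (α := α) hs₁
    have := measurable_reference (α := α) hs₁
    have := c.measurable_output₁
    have := measurable_channels (n := n) (n₀ := n₀) (m := m) (M := M) (U := U)
    fun_prop
  have hm₂ : Measurable R₂ := by
    have := measurable_mixtureDensity (α := α) c.measurable_signal₂
    have := measurable_smoothedLaw (α := α) hs₁
    have := c.measurable_output₂
    have := measurable_channels (n := n) (n₀ := n₀) (m := m) (M := M) (U := U)
    fun_prop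
  have hR₁le : ∫⁻ ω, R₁ ω ∂P ≤ 1 :=
    hG₁ _ (measurable_reference hs₁) (lintegral_reference_le_one hs₁)
  have hR₂le : ∫⁻ ω, R₂ ω ∂P ≤ 1 := c.lintegral_div_smoothedLaw_le_one laws μU hM hm
  have key : ∀ {R : Outcome n n₀ m M U → ENNReal}, Measurable R → ∫⁻ ω, R ω ∂P ≤ 1 →
      Integrable (fun ω => (R ω).toReal) P ∧ ∫ ω, (R ω).toReal ∂P ≤ 1 := fun {R} hR hle => by
    have hne := (hle.trans_lt ENNReal.one_lt_top).ne
    refine ⟨integrable_toReal_of_lintegral_ne_top hR.aemeasurable hne, ?_⟩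
    rw [integral_toReal hR.aemeasurable (ae_lt_top hR hne)]
    simpa using ENNReal.toReal_mono ENNReal.one_ne_top hle
  obtain ⟨hJ₁, hJ₁le⟩ := key hm₁ hR₁le
  obtain ⟨hJ₂, hJ₂le⟩ := key hm₂ hR₂le
  -- Positivity of `f` and `dmax ^ 2` comes from the existence of a coefficient law, hence needs `0
  -- < n`. For `n = 0` the power `A ^ (n * n₀)` is `1`.
  have hApos : 0 < n → 0 < A ∧ Real.log A = Real.log f + Real.log (dmax ^ 2 * (1 + m ^ 2)) :=
    fun hn => by
    have := laws.isProb₂ ⟨0, hn⟩ ⟨0, hn₀⟩ ⟨0, hm⟩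
    have h1 := (laws.density₂ ⟨0, hn⟩ ⟨0, hn₀⟩ ⟨0, hm⟩).inv_pi_le
      (laws.bounded₂ ⟨0, hn⟩ ⟨0, hn₀⟩ ⟨0, hm⟩)
    have h2 : 0 < f * dmax ^ 2 := (by positivity : 0 < Real.pi⁻¹).trans_le h1
    have h3 : (1 + m ^ 2 : ℝ) ≠ 0 := by positivity
    have hf0 : f ≠ 0 := left_ne_zero_of_mul h2.ne'
    have hd0 : dmax ^ 2 ≠ 0 := right_ne_zero_of_mul h2.ne'
    refine ⟨by positivity, ?_⟩
    rw [hA, mul_assoc, Real.log_mul hf0 (mul_ne_zero hd0 h3)]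
  have hAN : 0 < ENNReal.ofReal A ^ (n * n₀) := by
    rcases Nat.eq_zero_or_pos n with hn | hn
    · subst hn; simp
    · exact ENNReal.pow_pos (ENNReal.ofReal_pos.2 (hApos hn).1) _
  have hANt : ENNReal.ofReal A ^ (n * n₀) ≠ ⊤ := ENNReal.pow_ne_top ENNReal.ofReal_ne_top
  have hlogA : Real.log (ENNReal.ofReal A ^ (n * n₀)).toReal =
      n * n₀ * (Real.log f + Real.log (dmax ^ 2 * (1 + m ^ 2))) := by
    rcases Nat.eq_zero_or_pos n with hn | hn
    · subst hn; simp
    · rw [ENNReal.toReal_pow, ENNReal.toReal_ofReal (hApos hn).1.le, Real.log_pow, (hApos hn).2]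
      push_cast; ring
  set T : ℝ := 2 * Real.log (1 + Real.log (1 + p)) + 2
  -- The `- 2` collects the two terms `- 1` of Gibbs' inequality; it cancels the expectations of
  -- `R₁` and `R₂`.
  set c₀ : ℝ := n * n₀ * (Real.log f + Real.log (dmax ^ 2 * (1 + m ^ 2)) +
    Real.log (2 * taperedMass) + Real.log 2 + T) - 2 with hc₀
  -- `h1` and `h2` are Gibbs' inequality at the first and second receiver; `h4` lets the logarithms
  -- of the smoothed law cancel between them.
  have hpt : ∀ ω, -Real.log (mixtureDensity α c.signal₁ (c.output₁ ω, channels ω)).toReal +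
      Real.log (mixtureDensity α c.signal₂ (c.output₂ ω, channels ω)).toReal ≤
      c₀ + ∑ t, ∑ j, ‖ω.2.2.2.1 t j‖ ^ 2 + 2 / (1 + p) * ∑ t, ∑ j, ‖c.output₁ ω t j‖ ^ 2 +
        (R₁ ω).toReal + (R₂ ω).toReal := fun ω => by
    have hκ0 := smoothedLaw_pos (α := α) hs₁
      (c.signal₁ ((ω.1, ω.2.1), channels ω), channels ω)
    have hκt := smoothedLaw_ne_top (α := α) c.signal₁
      (c.signal₁ ((ω.1, ω.2.1), channels ω), channels ω)
    have h1 := neg_log_toReal_le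
      (mixtureDensity_pos (α := α) hs₁ (c.output₁ ω, channels ω))
      ((mixtureDensity_le_one _ _).trans_lt ENNReal.one_lt_top).ne
      (reference_pos (α := α) hs₁ (c.output₁ ω, channels ω)) (reference_ne_top _ _)
    have h2 := neg_log_toReal_le (ENNReal.mul_pos hAN.ne' hκ0.ne') (ENNReal.mul_ne_top hANt hκt)
      (mixtureDensity_pos (α := α) c.measurable_signal₂ (c.output₂ ω, channels ω))
      ((mixtureDensity_le_one _ _).trans_lt ENNReal.one_lt_top).ne
    rw [ENNReal.toReal_mul, Real.log_mul (ENNReal.toReal_pos hAN.ne' hANt).ne'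
      (ENNReal.toReal_pos hκ0.ne' hκt).ne', hlogA] at h2
    have h3 := neg_log_reference (α := α) hs₁ (c.output₁ ω, channels ω)
    have h4 := log_smoothedLaw_le (α := α) hs₁ (c.signal₁ ((ω.1, ω.2.1), channels ω))
      ω.2.2.2.1 (channels ω)
    rw [← c.output₁_eq] at h4
    simp only [Finset.sum_add_distrib, Finset.sum_const, Finset.card_univ, Fintype.card_fin,
      nsmul_eq_mul] at h4
    have h5 := neg_log_blockTaper_le hp (c.output₁ ω)
    simp only [hc₀, R₁, R₂]
    linarith
  have hY₁' := hY₁.const_mul (2 / (1 + p))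
  have hs2 := (integrable_const (μ := P) c₀).add hZ
  have hs3 := hs2.add hY₁'
  have hs4 := hs3.add hJ₁
  have hmono := integral_mono (hI₁.neg.add hI₂) (hs4.add hJ₂) hpt
  have hL := integral_add hI₁.neg hI₂
  simp only [Pi.neg_apply, integral_neg] at hL
  have hR := integral_add hs4 hJ₂
  have hR4 := integral_add hs3 hJ₁
  have hR3 := integral_add hs2 hY₁'
  have hR2 := integral_add (integrable_const (μ := P) c₀) hZ
  rw [integral_const_mul] at hR3
  rw [integral_const, probReal_univ, one_smul] at hR2
  simp only [Pi.add_apply, Pi.neg_apply] at hmono hR hR4 hR3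
  rw [hL, hR, hR4, hR3, hR2] at hmono
  have hYp : 2 / (1 + p) * ∫ ω, ∑ t, ∑ j, ‖c.output₁ ω t j‖ ^ 2 ∂P ≤
      n * n₀ * (4 * m * dmax ^ 2 + 4) := by
    calc _ ≤ 2 / (1 + p) * (n * n₀ * (2 * m * dmax ^ 2 * p + 2)) := by gcongr
      _ ≤ 2 / (1 + p) * (n * n₀ * (2 * m * dmax ^ 2 * (1 + p) + 2 * (1 + p))) := by
          gcongr <;> linarith
      _ = _ := by field_simp; ring
  rw [hE₁, hE₂]
  -- The `7` in `alignmentLoss` is `2` from the taper constant `T`, `1` from the noise power and `4`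
  -- from the output power.
  have hfin : c₀ + n * n₀ + n * n₀ * (4 * m * dmax ^ 2 + 4) + 1 + 1 =
      n * n₀ * Real.log f + n * n₀ * alignmentLoss m dmax p := by
    simp only [hc₀, T, alignmentLoss]; ring
  linarith

end Code

/-! ### Asymptotics of the error term and the main theorem -/

theorem isLittleO_alignmentLoss (m : ℕ) (dmax : ℝ) : alignmentLoss m dmax =o[atTop] Real.log := by
  have hc : ∀ b : ℝ, (fun _ : ℝ => b) =o[atTop] Real.log := fun b =>
    isLittleO_const_left.2 (Or.inr (tendsto_norm_atTop_atTop.comp Real.tendsto_log_atTop))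
  have hlin : (fun p : ℝ => 1 + Real.log (1 + p)) =O[atTop] Real.log := by
    have h1 : (fun p : ℝ => Real.log (1 + p)) =O[atTop] Real.log := by
      refine IsBigO.of_bound 2 ?_
      filter_upwards [eventually_ge_atTop 2] with p hp
      have h0 : 0 ≤ Real.log p := Real.log_nonneg (by linarith)
      rw [Real.norm_of_nonneg (Real.log_nonneg (by linarith)), Real.norm_of_nonneg h0]
      calc Real.log (1 + p) ≤ Real.log (p ^ 2) := Real.log_le_log (by linarith) (by nlinarith)
        _ = 2 * Real.log p := by rw [Real.log_pow]; push_cast; ring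
    exact (hc 1).isBigO.add h1
  have htend : Tendsto (fun p : ℝ => 1 + Real.log (1 + p)) atTop atTop :=
    tendsto_atTop_add_const_left _ _
      (Real.tendsto_log_atTop.comp (tendsto_atTop_add_const_left _ _ tendsto_id))
  have hloglog : (fun p : ℝ => 2 * Real.log (1 + Real.log (1 + p))) =o[atTop] Real.log :=
    ((Real.isLittleO_log_id_atTop.comp_tendsto htend).trans_isBigO hlin).const_mul_left 2
  exact (hc _).add hloglog

end
end LeastAlignment

open LeastAlignment in
theorem mainTheorem2 (m n₀ : ℕ) (hm : 1 ≤ m) (hn₀ : 1 ≤ n₀) (dmax : ℝ) (fmax : ℝ → ℝ) :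
    -- for arbitrary `fmax`, the error term being uniform in block length, channel laws and code
    (∃ ε : ℝ → ℝ, ε =o[atTop] Real.log ∧
      ∀ (p : ℝ), 0 < p → ∀ (n : ℕ) (laws : CoefLaws n n₀ m dmax (fmax p))
        (M : ℕ), 0 < M → ∀ (U : Type*) [MeasurableSpace U] (μU : Measure U)
        [IsProbabilityMeasure μU] (K : Fin n → Set (Fin n)) (c : Code n n₀ m M U K),
        c.PowerConstraint (outcomeLaw laws M μU) p →
          HasCondDiffEntropy (outcomeLaw laws M μU) c.output₁ channels ∧
          HasCondDiffEntropy (outcomeLaw laws M μU) c.output₂ channels ∧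
          condDiffEntropy (outcomeLaw laws M μU) c.output₁ channels ≤
            condDiffEntropy (outcomeLaw laws M μU) c.output₂ channels
              + n * n₀ * Real.log (fmax p) + n * ε p) ∧
    -- for `fmax = o(log p)`
    (fmax =o[atTop] Real.log →
      ∃ ε : ℝ → ℝ, ε =o[atTop] Real.log ∧
      ∀ (p : ℝ), 0 < p → ∀ (n : ℕ) (laws : CoefLaws n n₀ m dmax (fmax p))
        (M : ℕ), 0 < M → ∀ (U : Type*) [MeasurableSpace U] (μU : Measure U)
        [IsProbabilityMeasure μU] (K : Fin n → Set (Fin n)) (c : Code n n₀ m M U K),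
        c.PowerConstraint (outcomeLaw laws M μU) p →
          HasCondDiffEntropy (outcomeLaw laws M μU) c.output₁ channels ∧
          HasCondDiffEntropy (outcomeLaw laws M μU) c.output₂ channels ∧
          condDiffEntropy (outcomeLaw laws M μU) c.output₁ channels ≤
            condDiffEntropy (outcomeLaw laws M μU) c.output₂ channels + n * ε p) := by
  have hε := (isLittleO_alignmentLoss m dmax).const_mul_left (n₀ : ℝ)
  refine ⟨⟨fun p => n₀ * alignmentLoss m dmax p, hε, ?_⟩, fun hf =>
    ⟨fun p => n₀ * alignmentLoss m dmax p + n₀ * |fmax p|,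
      hε.add (hf.norm_left.const_mul_left (n₀ : ℝ)), ?_⟩⟩
  · intro p hp n laws M hM U _ μU _ K c h
    obtain ⟨h₁, h₂, hle⟩ := c.entropy_le laws μU hm hn₀ hM hp h
    exact ⟨h₁, h₂, by linarith⟩
  · intro p hp n laws M hM U _ μU _ K c h
    obtain ⟨h₁, h₂, hle⟩ := c.entropy_le laws μU hm hn₀ hM hp h
    -- The crude bound `log |x| ≤ |x|` suffices because `fmax` itself is `o(log p)`; the absolute
    -- value makes it valid for every real `fmax p`.
    have hlog : n * n₀ * Real.log (fmax p) ≤ n * n₀ * |fmax p| := by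
      gcongr
      rw [← Real.log_abs]
      exact Real.log_le_self (abs_nonneg _)
    exact ⟨h₁, h₂, by linarith⟩
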